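/- **Domain language and model.** Let $\mathbb D$ be the term model of the simply typed $\lambda$-calculus with a base type $\mathsf{tm}$, types $\mathsf{unit}$, $A\times B$, $A\to B$, and constants $\mathsf{app}:\mathsf{tm}\to\mathsf{tm}\to\mathsf{tm}$ and $\mathsf{lam}:(\mathsf{tm}\to\mathsf{tm})\to\mathsf{tm}$. Its objects are contexts (a type is regarded as a one-variable context) and its morphisms $\Psi\to\Phi$ are substitutions, for the variables of $\Phi$, of terms over $\Psi$, modulo $\beta\eta$. $\mathbb D$ is cartesian closed: $\top$ is the empty context, products are concatenations, and exponentials are function types between the tuple types of the contexts. Let $\hat{\mathbb D}$ be the category of presheaves of sets on $\mathbb D$, $\mathrm y$ the Yoneda embedding, and $\flat F$ the constant presheaf with value $F(\top)$. **Internal type theory of $\hat{\mathbb D}$.** Judgements are $\Delta\mid\Theta\vdash m:T$, with crisp variables $x::X$ (standing for $x:\flat X$) in $\Delta$ and ordinary variables in $\Theta$. Such a judgement is understood in the presheaf model: a crisp context denotes a constant presheaf, $T$ denotes a presheaf over it, and $m$ denotes a section of $T$ over $\Delta,\Theta$. The types are $\mathsf{Obj}$ (the constant presheaf on the objects of $\mathbb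 D$), $\mathsf{El}\,c$ for $c:\mathsf{Obj}$ (the representable $\mathrm y(c)$), $\Box T$ (interpreted by $\flat T$), functions $S\to T$, crisp functions $(x::S)\to^\flat T$ (functions on $\flat S$, where $T$ may depend on $x$), and $\mathsf{El}\,c\to_v\mathsf{El}\,a$ (the subtype of $\mathsf{El}\,c\to\mathsf{El}\,a$ that consists of the projections $\mathsf{snd}\circ\mathsf{fst}^k$). Types depend on crisp variables only. The terms are: * crisp and ordinary variables, abstraction $\lambda$ and application, crisp abstraction $\lambda^\Box$ and crisp application (whose argument has no ordinary variables), $\mathsf{box}\;m$ ($m$ without ordinary variables) and $\mathsf{let\ box}\;x=m\;\mathsf{in}\;n$ ($x$ crisp in $n$); * $\mathsf{unit},\mathsf{tm}:\mathsf{Obj}$ and $\mathsf{times},\mathsf{arrow}$ on $\mathsf{Obj}$ (denoting $\top$, $\mathsf{tm}$, product and exponential of $\mathbb D$), and $\mathsf{terminal}:\mathsf{El}\,\mathsf{unit}$; * $\mathsf{pair},\mathsf{fst},\mathsf{snd}$ for $\mathsf{El}(\mathsf{times}\,c\,d)$; $\mathsf{arrow\text{-}i}:(\mathsf{El}\,c\to\mathsf{El}\,d)\to\mathsf{El}(\mathsf{arrow}\,c\,d)$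 and $\mathsf{arrow\text{-}e}:\mathsf{El}(\mathsf{arrow}\,c\,d)\to\mathsf{El}\,c\to\mathsf{El}\,d$; $\mathsf{app}:\mathsf{El}\,\mathsf{tm}\to\mathsf{El}\,\mathsf{tm}\to\mathsf{El}\,\mathsf{tm}$ and $\mathsf{lam}:(\mathsf{El}\,\mathsf{tm}\to\mathsf{El}\,\mathsf{tm})\to\mathsf{El}\,\mathsf{tm}$; * $\mathsf{rec}\;t_v\;t_{app}\;t_{lam}\;c\;m:A\,c$, for $c:\mathsf{Obj}$ and $m:\Box(\mathsf{El}\,c\to\mathsf{El}\,\mathsf{tm})$, where $c$ and the branches have no ordinary variables, $t_v:(c::\mathsf{Obj})\to^\flat\Box(\mathsf{El}\,c\to_v\mathsf{El}\,\mathsf{tm})\to^\flat A\,c$, $t_{app}:(c::\mathsf{Obj})\to^\flat\Box(\mathsf{El}\,c\to\mathsf{El}\,\mathsf{tm})\to^\flat\Box(\mathsf{El}\,c\to\mathsf{El}\,\mathsf{tm})\to^\flat A\,c\to^\flat A\,c\to^\flat A\,c$, $t_{lam}:(c::\mathsf{Obj})\to^\flat\Box(\mathsf{El}(\mathsf{times}\,c\,\mathsf{tm})\to\mathsf{El}\,\mathsf{tm})\to^\flat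 A(\mathsf{times}\,c\,\mathsf{tm})\to^\flat A\,c$. It denotes primitive recursion over domain terms of type $\mathsf{tm}$ modulo $\beta\eta$, with cases for variables, $\mathsf{app}$ and $\mathsf{lam}$ (terms of none of these forms get a fixed default value). **Simply-typed Cocon.** The syntax is $A::=\mathsf{tm}\mid A\to B$; $M::=\lambda x.M\mid M\,N\mid x\mid\mathsf{lam}\mid\mathsf{app}\mid\lfloor t\rfloor_\sigma$; $\Psi::=\cdot\mid\psi\mid\Psi,x{:}A$; $\sigma::=\cdot\mid\mathsf{wk}_{\hat\Psi}\mid\sigma,M$ ($\hat\Psi$ is $\Psi$ with types erased); $T::=(\Psi\vdash A)\mid(\Psi\vdash_vA)$; $C::=(\hat\Psi\vdash M)$; $\tau::=\lceil T\rceil\mid(y{:}\check\tau_1)\Rightarrow\tau_2$, where $\check\tau::=\tau\mid\mathsf{ctx}$ and $y$ occurs in $\tau_2$ only if it is a context variable; $t::=y\mid\lceil C\rceil\mid\mathsf{rec}^{\mathcal I}(b_v\mid b_{app}\mid b_{lam})\,\Psi\,t\mid\mathsf{fn}\,y\Rightarrow t\mid t_1\,t_2$; $\Gamma::=\cdot\mid\Gamma,y{:}\check\tau$.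 The typing rules are as follows. * $\Gamma\vdash\Psi:\mathsf{ctx}$ if the context variable of $\Psi$, if any, is declared with $\mathsf{ctx}$ in $\Gamma$. $\Gamma\vdash\tau:\mathsf{type}$ and $\vdash\Gamma$ if all domain contexts in them are well-formed. * $\Gamma;\Psi\vdash M:A$: the usual rules for variables, abstraction, application and the two constants (with $\Gamma\vdash\Psi:\mathsf{ctx}$), and $\Gamma;\Psi\vdash\lfloor t\rfloor_\sigma:A$ if $\Gamma;\Psi\vdash\sigma:\Phi$ and $\Gamma\vdash t:\lceil\Phi\vdash A\rceil$ or $\Gamma\vdash t:\lceil\Phi\vdash_vA\rceil$. * $\Gamma;\Phi\vdash\cdot:\cdot$ if $\Gamma\vdash\Phi:\mathsf{ctx}$; $\Gamma;\Psi,\vec x{:}\vec A\vdash\mathsf{wk}_{\hat\Psi}:\Psi$ if $\Gamma\vdash\Psi,\vec x{:}\vec A:\mathsf{ctx}$; $\Gamma;\Phi\vdash(\sigma,M):(\Psi,x{:}A)$ if $\Gamma;\Phi\vdash\sigma:\Psi$ and $\Gamma;\Phi\vdash M:A$. * $\Gamma\vdash(\hat\Psi\vdash M):(\Psi\vdash A)$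 if $\Gamma;\Psi\vdash M:A$; $\Gamma\vdash(\hat\Psi\vdash x):(\Psi\vdash_vA)$ if $\Gamma\vdash\Psi:\mathsf{ctx}$ and $x{:}A\in\Psi$; $\Gamma\vdash(\hat\Psi\vdash\lfloor x\rfloor_{\mathsf{wk}}):(\Psi\vdash_vA)$ if $x{:}\lceil\Phi\vdash_vA\rceil\in\Gamma$ and $\mathsf{wk}$ is a weakening substitution with $\Gamma;\Psi\vdash\mathsf{wk}:\Phi$. * $\Gamma\vdash t:\tau$: variables; $\Gamma\vdash\lceil C\rceil:\lceil T\rceil$ if $\Gamma\vdash C:T$; $\Gamma\vdash t\,s:[s/y]\tau_2$ if $\Gamma\vdash t:(y{:}\check\tau_1)\Rightarrow\tau_2$ and $\Gamma\vdash s:\check\tau_1$; $\Gamma\vdash\mathsf{fn}\,y\Rightarrow t:(y{:}\check\tau_1)\Rightarrow\tau_2$ if $\Gamma,y{:}\check\tau_1\vdash t:\tau_2$ and this function type is well-formed over $\Gamma$; and, for $\mathcal I=(\psi{:}\mathsf{ctx})\Rightarrow(y{:}\lceil\psi\vdash\mathsf{tm}\rceil)\Rightarrow\tau$ with $\Gamma\vdash\mathcal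 I:\mathsf{type}$, $\Gamma\vdash\mathsf{rec}^{\mathcal I}(\psi,p\mapsto t_v\mid\psi,m,n,f_m,f_n\mapsto t_{app}\mid\phi,m,f_m\mapsto t_{lam})\,\Psi\,t:[\Psi/\psi]\tau$ if $\Gamma\vdash t:\lceil\Psi\vdash\mathsf{tm}\rceil$, $\Gamma,\psi{:}\mathsf{ctx},p{:}\lceil\psi\vdash_v\mathsf{tm}\rceil\vdash t_v:\tau$, $\Gamma,\psi{:}\mathsf{ctx},m{:}\lceil\psi\vdash\mathsf{tm}\rceil,n{:}\lceil\psi\vdash\mathsf{tm}\rceil,f_m{:}\tau,f_n{:}\tau\vdash t_{app}:\tau$ and $\Gamma,\phi{:}\mathsf{ctx},m{:}\lceil\phi,x{:}\mathsf{tm}\vdash\mathsf{tm}\rceil,f_m{:}[(\phi,x{:}\mathsf{tm})/\psi]\tau\vdash t_{lam}:[\phi/\psi]\tau$. **Interpretation.** $[\![-]\!]$ sends derivations to expressions of the internal type theory. * Domain types and contexts: $[\![\mathsf{tm}]\!]=\mathsf{tm}$, $[\![A\to B]\!]=\mathsf{arrow}\,[\![A]\!]\,[\![B]\!]$; $[\![\psi]\!]=\psi$,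 $[\![\cdot]\!]=\mathsf{unit}$, $[\![\Psi,x{:}A]\!]=\mathsf{times}\,[\![\Psi]\!]\,[\![A]\!]$. * Domain terms, each under $\lambda u{:}\mathsf{El}[\![\Psi]\!]$: the variable followed by $k$ declarations is $\mathsf{snd}(\mathsf{fst}^k\,u)$; $\lambda x.M$ with $x{:}A$ is $\mathsf{arrow\text{-}i}(\lambda x{:}\mathsf{El}[\![A]\!].\,[\![M]\!](\mathsf{pair}\,u\,x))$; $M\,N$ is $\mathsf{arrow\text{-}e}([\![M]\!]u)([\![N]\!]u)$; $\mathsf{app}$ is $\mathsf{arrow\text{-}i}(\lambda x.\mathsf{arrow\text{-}i}(\lambda y.\mathsf{app}\,x\,y))$; $\mathsf{lam}$ is $\mathsf{arrow\text{-}i}(\lambda f.\mathsf{lam}(\lambda x.\mathsf{arrow\text{-}e}\,f\,x))$. Unboxing: $[\![\lfloor t\rfloor_\sigma]\!]=\mathsf{let\ box}\;x=[\![t]\!]\;\mathsf{in}\;\lambda u{:}\mathsf{El}[\![\Psi]\!].\,x([\![\sigma]\!]u)$. * Substitutions, under the same $\lambda u$: $\cdot$ is $\mathsf{terminal}$; $(\sigma,M)$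 is $\mathsf{pair}([\![\sigma]\!]u)([\![M]\!]u)$; weakening by $n$ declarations is $\mathsf{fst}^n\,u$. * $[\![\hat\Psi\vdash M]\!]=[\![M]\!]$; $[\![\Psi\vdash A]\!]=\mathsf{El}[\![\Psi]\!]\to\mathsf{El}[\![A]\!]$, $[\![\Psi\vdash_vA]\!]=\mathsf{El}[\![\Psi]\!]\to_v\mathsf{El}[\![A]\!]$. * $[\![\lceil T\rceil]\!]=\Box[\![T]\!]$, $[\![\mathsf{ctx}]\!]=\mathsf{Obj}$, $[\![(y{:}\check\tau_1)\Rightarrow\tau_2]\!]=(y::[\![\check\tau_1]\!])\to^\flat[\![\tau_2]\!]$; $[\![\Gamma,y{:}\check\tau]\!]=[\![\Gamma]\!],y::[\![\check\tau]\!]$. * $[\![y]\!]=y$, $[\![\lceil C\rceil]\!]=\mathsf{box}\,[\![C]\!]$, application is crisp application, $\mathsf{fn}\,y\Rightarrow t$ is $\lambda^\Box y::[\![\check\tau_1]\!].[\![t]\!]$, and the recursor is $\mathsf{rec}\,e_v\,e_{app}\,e_{lam}\,[\![\Psi]\!]\,[\![t]\!]$, where $e_v,e_{app},e_{lam}$ are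 the $\lambda^\Box$-abstractions of $[\![t_v]\!],[\![t_{app}]\!],[\![t_{lam}]\!]$ over the interpreted branch variables. **Lemma.** Let $\Gamma$ be a well-formed computation context. Then $[\![\Gamma]\!]$ is a well-formed crisp context, and for every derivation of the judgement on the left the following holds, where the types on the right are well-formed. 1. If $\Gamma\vdash\Psi:\mathsf{ctx}$ then $[\![\Gamma]\!]\mid\cdot\vdash[\![\Gamma\vdash\Psi:\mathsf{ctx}]\!]:\mathsf{Obj}$. 2. If $\Gamma;\Psi\vdash M:A$ then $[\![\Gamma]\!]\mid\cdot\vdash[\![\Gamma;\Psi\vdash M:A]\!]:\mathsf{El}[\![\Psi]\!]\to\mathsf{El}[\![A]\!]$. 3. If $\Gamma;\Psi\vdash\sigma:\Phi$ then $[\![\Gamma]\!]\mid\cdot\vdash[\![\Gamma;\Psi\vdash\sigma:\Phi]\!]:\mathsf{El}[\![\Psi]\!]\to\mathsf{El}[\![\Phi]\!]$. 4. If $\Gamma\vdash C:T$ then $[\![\Gamma]\!]\mid\cdot\vdash[\![\Gamma\vdash C:T]\!]:[\![T]\!]$. 5. If $\Gamma\vdash t:\tau$ then $[\![\Gamma]\!]\mid\cdot\vdash[\![\Gamma\vdash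 t:\tau]\!]:[\![\tau]\!]$. -/

import Mathlib

open CategoryTheory MonoidalCategory CartesianMonoidalCategory

namespace SimpleCocon

/-- Types of the simply typed domain language: the base type `tm`, unit, products and functions. -/
inductive DomTy : Type
  | tm | unit
  | prod (A B : DomTy)
  | arr (A B : DomTy)

/-- Domain contexts; the head of the list is the most recently declared variable. -/
abbrev DomCtx : Type := List DomTy

/-- Typed de Bruijn variables. -/
inductive DomVar : DomCtx → DomTy → Type
  | zero {Φ : DomCtx} {A : DomTy} : DomVar (A :: Φ) A
  | succ {Φ : DomCtx} {A B : DomTy} (x : DomVar Φ A) : DomVar (B :: Φ) A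

/-- Intrinsically typed domain terms, with the constants `app : tm → tm → tm` (`cApp`) and
`lam : (tm → tm) → tm` (`cLam`). -/
inductive DomTm : DomCtx → DomTy → Type
  | var {Φ : DomCtx} {A : DomTy} (x : DomVar Φ A) : DomTm Φ A
  | lam {Φ : DomCtx} {A B : DomTy} (t : DomTm (A :: Φ) B) : DomTm Φ (.arr A B)
  | app {Φ : DomCtx} {A B : DomTy} (t : DomTm Φ (.arr A B)) (u : DomTm Φ A) : DomTm Φ B
  | star {Φ : DomCtx} : DomTm Φ .unit
  | pair {Φ : DomCtx} {A B : DomTy} (t : DomTm Φ A) (u : DomTm Φ B) : DomTm Φ (.prod A B)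
  | fst {Φ : DomCtx} {A B : DomTy} (t : DomTm Φ (.prod A B)) : DomTm Φ A
  | snd {Φ : DomCtx} {A B : DomTy} (t : DomTm Φ (.prod A B)) : DomTm Φ B
  | cApp {Φ : DomCtx} : DomTm Φ (.arr .tm (.arr .tm .tm))
  | cLam {Φ : DomCtx} : DomTm Φ (.arr (.arr .tm .tm) .tm)

/-- Renamings of the variables of `Φ` by variables of `Ψ`. -/
abbrev DomRen (Ψ Φ : DomCtx) : Type := ∀ A : DomTy, DomVar Φ A → DomVar Ψ A
/-- Simultaneous substitutions of terms over `Ψ` for the variables of `Φ`. -/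
abbrev DomSub (Ψ Φ : DomCtx) : Type := ∀ A : DomTy, DomVar Φ A → DomTm Ψ A

def DomRen.up {Ψ Φ : DomCtx} (B : DomTy) (r : DomRen Ψ Φ) : DomRen (B :: Ψ) (B :: Φ)
  | _, .zero => .zero
  | _, .succ x => .succ (r _ x)

def DomTm.ren {Ψ Φ : DomCtx} (r : DomRen Ψ Φ) {A : DomTy} : DomTm Φ A → DomTm Ψ A
  | .var x => .var (r _ x)
  | .lam t => .lam (t.ren (r.up _))
  | .app t u => .app (t.ren r) (u.ren r)
  | .star => .star
  | .pair t u => .pair (t.ren r) (u.ren r)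
  | .fst t => .fst (t.ren r)
  | .snd t => .snd (t.ren r)
  | .cApp => .cApp
  | .cLam => .cLam

def DomTm.wk {Φ : DomCtx} {A B : DomTy} (t : DomTm Φ A) : DomTm (B :: Φ) A :=
  t.ren (fun _ x => .succ x)

def DomSub.up {Ψ Φ : DomCtx} (B : DomTy) (s : DomSub Ψ Φ) : DomSub (B :: Ψ) (B :: Φ)
  | _, .zero => .var .zero
  | _, .succ x => (s _ x).wk

def DomTm.sub {Ψ Φ : DomCtx} (s : DomSub Ψ Φ) {A : DomTy} : DomTm Φ A → DomTm Ψ A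
  | .var x => s _ x
  | .lam t => .lam (t.sub (s.up _))
  | .app t u => .app (t.sub s) (u.sub s)
  | .star => .star
  | .pair t u => .pair (t.sub s) (u.sub s)
  | .fst t => .fst (t.sub s)
  | .snd t => .snd (t.sub s)
  | .cApp => .cApp
  | .cLam => .cLam

def DomSub.id (Φ : DomCtx) : DomSub Φ Φ := fun _ x => .var x
def DomSub.comp {Ξ Ψ Φ : DomCtx} (s : DomSub Ξ Ψ) (t : DomSub Ψ Φ) : DomSub Ξ Φ :=
  fun _ x => (t _ x).sub s
def DomSub.cons {Ψ Φ : DomCtx} {A : DomTy} (s : DomSub Ψ Φ) (t : DomTm Ψ A) : DomSub Ψ (A :: Φ)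
  | _, .zero => t
  | _, .succ x => s _ x

/-- Definitional equality (the congruence generated by `β` and `η`) of domain terms. -/
inductive DomTm.Conv : {Φ : DomCtx} → {A : DomTy} → DomTm Φ A → DomTm Φ A → Prop
  | refl {Φ : DomCtx} {A : DomTy} (t : DomTm Φ A) : Conv t t
  | symm {Φ : DomCtx} {A : DomTy} {t u : DomTm Φ A} : Conv t u → Conv u t
  | trans {Φ : DomCtx} {A : DomTy} {t u v : DomTm Φ A} : Conv t u → Conv u v → Conv t v
  | lam {Φ : DomCtx} {A B : DomTy} {t t' : DomTm (A :: Φ) B} :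
      Conv t t' → Conv (.lam t) (.lam t')
  | app {Φ : DomCtx} {A B : DomTy} {t t' : DomTm Φ (.arr A B)} {u u' : DomTm Φ A} :
      Conv t t' → Conv u u' → Conv (.app t u) (.app t' u')
  | pair {Φ : DomCtx} {A B : DomTy} {t t' : DomTm Φ A} {u u' : DomTm Φ B} :
      Conv t t' → Conv u u' → Conv (.pair t u) (.pair t' u')
  | fst {Φ : DomCtx} {A B : DomTy} {t t' : DomTm Φ (.prod A B)} :
      Conv t t' → Conv (.fst t) (.fst t')
  | snd {Φ : DomCtx} {A B : DomTy} {t t' : DomTm Φ (.prod A B)} :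
      Conv t t' → Conv (.snd t) (.snd t')
  | beta {Φ : DomCtx} {A B : DomTy} (t : DomTm (A :: Φ) B) (u : DomTm Φ A) :
      Conv (.app (.lam t) u) (t.sub ((DomSub.id Φ).cons u))
  | eta {Φ : DomCtx} {A B : DomTy} (t : DomTm Φ (.arr A B)) :
      Conv t (.lam (.app t.wk (.var .zero)))
  | fst_pair {Φ : DomCtx} {A B : DomTy} (t : DomTm Φ A) (u : DomTm Φ B) :
      Conv (.fst (.pair t u)) t
  | snd_pair {Φ : DomCtx} {A B : DomTy} (t : DomTm Φ A) (u : DomTm Φ B) :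
      Conv (.snd (.pair t u)) u
  | pair_eta {Φ : DomCtx} {A B : DomTy} (t : DomTm Φ (.prod A B)) :
      Conv t (.pair (.fst t) (.snd t))
  | unit_eta {Φ : DomCtx} (t : DomTm Φ .unit) : Conv t .star

/-! ### Substitution calculus of the domain language -/

theorem DomTm.ren_sub {Φ : DomCtx} {A : DomTy} (t : DomTm Φ A) : ∀ {Ψ Ξ : DomCtx}
    (r : DomRen Ψ Φ) (s : DomSub Ξ Ψ), (t.ren r).sub s = t.sub (fun _ x => s _ (r _ x)) := by
  induction t with
  | lam t ih =>
    intro Ψ Ξ r s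
    simp only [DomTm.ren, DomTm.sub, ih]
    congr 2; funext A x; cases x <;> rfl
  | _ => intros; simp_all [DomTm.ren, DomTm.sub]

theorem DomTm.ren_ren {Φ : DomCtx} {A : DomTy} (t : DomTm Φ A) : ∀ {Ψ Ξ : DomCtx}
    (r : DomRen Ψ Φ) (s : DomRen Ξ Ψ), (t.ren r).ren s = t.ren (fun _ x => s _ (r _ x)) := by
  induction t with
  | lam t ih =>
    intro Ψ Ξ r s
    simp only [DomTm.ren, ih]
    congr 2; funext A x; cases x <;> rfl
  | _ => intros; simp_all [DomTm.ren]

theorem DomTm.sub_ren {Φ : DomCtx} {A : DomTy} (t : DomTm Φ A) : ∀ {Ψ Ξ : DomCtx}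
    (s : DomSub Ψ Φ) (r : DomRen Ξ Ψ), (t.sub s).ren r = t.sub (fun _ x => (s _ x).ren r) := by
  induction t with
  | lam t ih =>
    intro Ψ Ξ s r
    simp only [DomTm.ren, DomTm.sub, ih]
    congr 2; funext A x; cases x
    · rfl
    · simp only [DomSub.up, DomTm.wk, DomTm.ren_ren]; rfl
  | _ => intros; simp_all [DomTm.ren, DomTm.sub]

theorem DomTm.sub_sub {Φ : DomCtx} {A : DomTy} (t : DomTm Φ A) : ∀ {Ψ Ξ : DomCtx}
    (s : DomSub Ψ Φ) (r : DomSub Ξ Ψ), (t.sub s).sub r = t.sub (r.comp s) := by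
  induction t with
  | lam t ih =>
    intro Ψ Ξ s r
    simp only [DomTm.sub, ih]
    congr 2; funext A x; cases x
    · rfl
    · simp only [DomSub.comp, DomSub.up, DomTm.wk, DomTm.ren_sub, DomTm.sub_ren]
  | _ => intros; simp_all [DomTm.sub, DomSub.comp]

theorem DomTm.sub_id {Φ : DomCtx} {A : DomTy} (t : DomTm Φ A) : t.sub (DomSub.id Φ) = t := by
  induction t with
  | lam t ih =>
    simp only [DomTm.sub]
    congr 1
    refine Eq.trans ?_ ih
    congr 1; funext A x; cases x <;> rfl
  | _ => simp_all [DomTm.sub, DomSub.id]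

theorem DomTm.ren_eq_sub {Φ : DomCtx} {A : DomTy} (t : DomTm Φ A) {Ψ : DomCtx}
    (r : DomRen Ψ Φ) : t.ren r = t.sub (fun _ x => .var (r _ x)) := by
  rw [← (t.ren r).sub_id, t.ren_sub]; rfl

theorem DomTm.wk_sub {Ψ Φ : DomCtx} {A B : DomTy} (t : DomTm Φ A) (s : DomSub (B :: Ψ) (B :: Φ)) :
    (t.wk : DomTm (B :: Φ) A).sub s = t.sub (fun _ x => s _ (.succ x)) := t.ren_sub _ _

theorem DomTm.Conv.sub {Φ : DomCtx} {A : DomTy} {t u : DomTm Φ A} (h : Conv t u) :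
    ∀ {Ψ : DomCtx} (s : DomSub Ψ Φ), Conv (t.sub s) (u.sub s) := by
  induction h with
  | refl t => exact fun s => .refl _
  | symm _ ih => exact fun s => (ih s).symm
  | trans _ _ ih ih' => exact fun s => (ih s).trans (ih' s)
  | lam _ ih => exact fun s => .lam (ih _)
  | app _ _ ih ih' => exact fun s => .app (ih s) (ih' s)
  | pair _ _ ih ih' => exact fun s => .pair (ih s) (ih' s)
  | fst _ ih => exact fun s => .fst (ih s)
  | snd _ ih => exact fun s => .snd (ih s)
  | beta t u =>
    intro Ψ s
    have := Conv.beta (t.sub (s.up _)) (u.sub s)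
    refine Eq.subst (motive := Conv _) ?_ this
    rw [DomTm.sub_sub, DomTm.sub_sub]
    congr 1; funext A x; cases x
    · rfl
    · simp only [DomSub.comp, DomSub.cons, DomSub.up, DomTm.wk, DomTm.ren_sub]
      exact DomTm.sub_id _
  | eta t =>
    intro Ψ s
    have := Conv.eta (t.sub s)
    convert this using 1
    simp only [DomTm.sub, DomTm.wk, DomTm.ren_sub, DomTm.sub_ren]
    rfl
  | fst_pair t u => exact fun s => .fst_pair _ _
  | snd_pair t u => exact fun s => .snd_pair _ _
  | pair_eta t => exact fun s => .pair_eta _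
  | unit_eta t => exact fun s => .unit_eta _

theorem DomTm.Conv.sub_congr {Φ : DomCtx} {A : DomTy} (t : DomTm Φ A) :
    ∀ {Ψ : DomCtx} {s s' : DomSub Ψ Φ}, (∀ A x, Conv (s A x) (s' A x)) →
      Conv (t.sub s) (t.sub s') := by
  induction t with
  | var x => exact fun h => h _ x
  | lam t ih =>
    refine fun h => .lam (ih fun A x => ?_)
    cases x with
    | zero => exact .refl _
    | succ x =>
      simp only [DomSub.up, DomTm.wk, DomTm.ren_eq_sub]
      exact (h _ x).sub _
  | app t u ih ih' => exact fun h => .app (ih h) (ih' h)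
  | star => exact fun h => .refl _
  | pair t u ih ih' => exact fun h => .pair (ih h) (ih' h)
  | fst t ih => exact fun h => .fst (ih h)
  | snd t ih => exact fun h => .snd (ih h)
  | cApp => exact fun h => .refl _
  | cLam => exact fun h => .refl _

theorem DomTm.Conv.beta_wk {Φ : DomCtx} {A B : DomTy} (t : DomTm (A :: Φ) B) :
    Conv (.app (DomTm.lam t).wk (.var .zero)) t := by
  refine (Conv.beta _ _).trans ?_
  rw [DomTm.ren_sub]
  refine Eq.subst (motive := DomTm.Conv _) t.sub_id (DomTm.Conv.sub_congr _ fun A x => ?_)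
  cases x <;> exact .refl _

/-- Pointwise definitional equality of substitutions. -/
def DomSub.setoid (Ψ Φ : DomCtx) : Setoid (DomSub Ψ Φ) where
  r s s' := ∀ A x, (s A x).Conv (s' A x)
  iseqv := ⟨fun _ _ _ => .refl _, fun h A x => (h A x).symm, fun h h' A x => (h A x).trans (h' A x)⟩

/-- The term model of the domain language: its objects are the contexts. -/
structure Dom : Type where
  ctx : DomCtx

/-- Morphisms `Ψ ⟶ Φ`: substitutions for the variables of `Φ` by terms over `Ψ`, up to `βη`. -/
def Dom.Hom (Ψ Φ : Dom) : Type := Quotient (DomSub.setoid Ψ.ctx Φ.ctx)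

instance : Category Dom where
  Hom := Dom.Hom
  id Φ := Quotient.mk _ (DomSub.id Φ.ctx)
  comp := Quotient.map₂ (fun s t => s.comp t) (fun s s' h t t' h' A x =>
    ((h' A x).sub s).trans (DomTm.Conv.sub_congr _ h))
  id_comp := by
    rintro Ψ Φ ⟨s⟩
    exact congrArg (Quotient.mk _) (funext fun A => funext fun x => DomTm.sub_id _)
  comp_id := by
    rintro Ψ Φ ⟨s⟩; rfl
  assoc := by
    rintro A B C D ⟨s⟩ ⟨t⟩ ⟨u⟩
    exact congrArg (Quotient.mk _) (funext fun A => funext fun x => (DomTm.sub_sub _ _ _).symm)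

def Dom.homMk {Ψ Φ : Dom} (s : DomSub Ψ.ctx Φ.ctx) : Ψ ⟶ Φ :=
  Quotient.mk (DomSub.setoid Ψ.ctx Φ.ctx) s

theorem Dom.sound {Ψ Φ : Dom} {s s' : DomSub Ψ.ctx Φ.ctx} (h : ∀ A x, (s A x).Conv (s' A x)) :
    (Dom.homMk s : Ψ ⟶ Φ) = Dom.homMk s' := Quotient.sound h

/-! ### Finite products and exponentials of the term model -/
def DomVar.left : {Ψ Φ : DomCtx} → {A : DomTy} → DomVar Φ A → DomVar (Ψ ++ Φ) A
  | [], _, _, x => x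
  | _ :: Ψ, _, _, x => .succ (DomVar.left (Ψ := Ψ) x)

def DomVar.right {Φ : DomCtx} : {Ψ : DomCtx} → {A : DomTy} → DomVar Ψ A → DomVar (Ψ ++ Φ) A
  | _, _, .zero => .zero
  | _, _, .succ x => .succ (DomVar.right x)

def DomSub.pair {Ξ Φ : DomCtx} (s : DomSub Ξ Φ) : {Ψ : DomCtx} → DomSub Ξ Ψ → DomSub Ξ (Ψ ++ Φ)
  | [], _ => s
  | _ :: _, t => (s.pair (fun _ x => t _ (.succ x))).cons (t _ .zero)

theorem DomSub.pair_left {Ξ Φ : DomCtx} (s : DomSub Ξ Φ) {Ψ : DomCtx} (t : DomSub Ξ Ψ)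
    {A : DomTy} (x : DomVar Φ A) : s.pair t A (.left x) = s A x := by
  induction Ψ with
  | nil => rfl
  | cons B Ψ ih => exact ih _

theorem DomSub.pair_right {Ξ Φ : DomCtx} (s : DomSub Ξ Φ) {Ψ : DomCtx} (t : DomSub Ξ Ψ)
    {A : DomTy} (x : DomVar Ψ A) : s.pair t A (.right x) = t A x := by
  induction x with
  | zero => rfl
  | succ x ih => exact ih (fun _ x => t _ (.succ x))

theorem DomSub.pair_conv {Ξ Φ : DomCtx} {s : DomSub Ξ Φ} {Ψ : DomCtx} {t : DomSub Ξ Ψ}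
    {u : DomSub Ξ (Ψ ++ Φ)} (h : ∀ A x, (u A (.left x)).Conv (s A x))
    (h' : ∀ A x, (u A (.right x)).Conv (t A x)) (A : DomTy) (x : DomVar (Ψ ++ Φ) A) :
    (u A x).Conv (s.pair t A x) := by
  induction Ψ with
  | nil => exact h A x
  | cons B Ψ ih =>
    cases x with
    | zero => exact h' _ .zero
    | succ x => exact ih (u := fun _ x => u _ (.succ x)) h (fun _ y => h' _ (.succ y)) x

open Limits in
def Dom.fan (Φ Ψ : Dom) : BinaryFan Φ Ψ :=
  BinaryFan.mk (P := (⟨Ψ.ctx ++ Φ.ctx⟩ : Dom)) (Dom.homMk fun _ x => .var (.left x))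
    (Dom.homMk fun _ x => .var (.right x))

def Dom.pair {Ξ Φ Ψ : Dom} : (Ξ ⟶ Φ) → (Ξ ⟶ Ψ) → (Ξ ⟶ (⟨Ψ.ctx ++ Φ.ctx⟩ : Dom)) :=
  Quotient.map₂ (fun s t => s.pair t) (fun s s' h t t' h' =>
    DomSub.pair_conv (fun A x => by rw [DomSub.pair_left]; exact h A x)
      (fun A x => by rw [DomSub.pair_right]; exact h' A x))

open Limits in
def Dom.isLimitFan (Φ Ψ : Dom) : IsLimit (Dom.fan Φ Ψ) :=
  BinaryFan.IsLimit.mk _ (fun f g => Dom.pair f g)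
    (by
      rintro Ξ ⟨s⟩ ⟨t⟩
      exact congrArg (Quotient.mk _) (funext fun A => funext fun x => DomSub.pair_left s t x))
    (by
      rintro Ξ ⟨s⟩ ⟨t⟩
      exact congrArg (Quotient.mk _) (funext fun A => funext fun x => DomSub.pair_right s t x))
    (by
      rintro Ξ ⟨s⟩ ⟨t⟩ ⟨u⟩ h h'
      exact Quotient.sound (DomSub.pair_conv (Quotient.exact h) (Quotient.exact h')))

open Limits in
def Dom.isTerminalNil : IsTerminal (⟨[]⟩ : Dom) :=
  IsTerminal.ofUniqueHom (fun _ => Dom.homMk (fun _ x => nomatch x)) (by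
    rintro Ψ ⟨s⟩; exact Dom.sound (fun A x => nomatch x))

instance : CartesianMonoidalCategory Dom :=
  .ofChosenFiniteProducts ⟨_, Dom.isTerminalNil⟩ (fun Φ Ψ => ⟨_, Dom.isLimitFan Φ Ψ⟩)

abbrev Dom.single (A : DomTy) : Dom := ⟨[A]⟩

def DomSub.single {Φ : DomCtx} {A : DomTy} (t : DomTm Φ A) : DomSub Φ [A]
  | _, .zero => t

/-- Abstraction over the last variable. -/
def Dom.lamEquiv {Φ : Dom} {A B : DomTy} :
    (Φ ⊗ .single A ⟶ .single B) ≃ (Φ ⟶ .single (.arr A B)) where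
  toFun := Quotient.map (fun s => DomSub.single (.lam (s B .zero))) (by
    rintro s s' h _ (_ | ⟨⟨⟩⟩); exact .lam (h _ .zero))
  invFun := Quotient.map (fun s => DomSub.single (.app (s _ .zero).wk (.var .zero))) (by
    rintro s s' h _ (_ | ⟨⟨⟩⟩)
    refine .app ?_ (.refl _)
    simp only [DomTm.wk, DomTm.ren_eq_sub]
    exact (h _ .zero).sub _)
  left_inv := by
    rintro ⟨s⟩
    refine Dom.sound ?_
    rintro _ (_ | ⟨⟨⟩⟩)
    exact DomTm.Conv.beta_wk (s _ .zero)
  right_inv := by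
    rintro ⟨s⟩
    refine Dom.sound ?_
    rintro _ (_ | ⟨⟨⟩⟩)
    exact (DomTm.Conv.eta _).symm

theorem Dom.lamEquiv_comp {Ψ Φ : Dom} {A B : DomTy} (f : Ψ ⟶ Φ) (g : Φ ⊗ .single A ⟶ .single B) :
    Dom.lamEquiv ((f ▷ _) ≫ g) = f ≫ Dom.lamEquiv g := by
  have hf : f ▷ Dom.single A = lift (fst _ _ ≫ f) (snd _ _) := by ext <;> simp
  rw [hf]
  obtain ⟨s⟩ := f
  obtain ⟨t⟩ := g
  refine Dom.sound ?_
  rintro _ (_ | ⟨⟨⟩⟩)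
  refine .lam (DomTm.Conv.sub_congr _ fun A x => ?_)
  cases x with
  | zero => exact .refl _
  | succ x =>
    simp only [DomSub.up, DomTm.wk, DomTm.ren_eq_sub]
    exact .refl _

/-- The type of tuples of values for the variables of a context. -/
def DomTy.tuple : DomCtx → DomTy
  | [] => .unit
  | [A] => A
  | A :: B :: Φ => .prod (DomTy.tuple (B :: Φ)) A

def Dom.unitIso : 𝟙_ Dom ≅ .single .unit where
  hom := Dom.homMk (DomSub.single .star)
  inv := toUnit _
  hom_inv_id := toUnit_unique _ _
  inv_hom_id := Dom.sound (by
    rintro _ (_ | ⟨⟨⟩⟩); exact (DomTm.Conv.unit_eta _).symm)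

def Dom.prodIso (A B : DomTy) : (.single A ⊗ .single B : Dom) ≅ .single (.prod A B) where
  hom := Dom.homMk (Ψ := ⟨[B, A]⟩)
    (DomSub.single (.pair (.var (.succ .zero)) (.var .zero)))
  inv := Dom.homMk (Φ := ⟨[B, A]⟩)
    ((DomSub.single (.fst (.var .zero))).cons (.snd (.var .zero)))
  hom_inv_id := Dom.sound (by
    rintro _ (_ | ⟨_ | ⟨⟨⟩⟩⟩)
    · exact .snd_pair _ _
    · exact .fst_pair _ _)
  inv_hom_id := Dom.sound (by
    rintro _ (_ | ⟨⟨⟩⟩); exact (DomTm.Conv.pair_eta _).symm)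

def Dom.tupleIso : (Φ : DomCtx) → ((⟨Φ⟩ : Dom) ≅ .single (DomTy.tuple Φ))
  | [] => Dom.unitIso
  | [_] => Iso.refl _
  | A :: B :: Φ => whiskerRightIso (Dom.tupleIso (B :: Φ)) (.single A) ≪≫ Dom.prodIso _ A

/-- The exponential of `Dom`: contexts are regarded as types through tuples. -/
def Dom.arrow (Φ Ψ : Dom) : Dom := .single (.arr (DomTy.tuple Φ.ctx) (DomTy.tuple Ψ.ctx))

/-- The universal property of the exponential. -/
def Dom.curryEquiv (Ξ Φ Ψ : Dom) : (Ξ ⊗ Φ ⟶ Ψ) ≃ (Ξ ⟶ Dom.arrow Φ Ψ) :=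
  (Iso.homCongr (whiskerLeftIso Ξ (Dom.tupleIso Φ.ctx)) (Dom.tupleIso Ψ.ctx)).trans Dom.lamEquiv

theorem Dom.curryEquiv_comp {Ξ Ξ' Φ Ψ : Dom} (f : Ξ' ⟶ Ξ) (g : Ξ ⊗ Φ ⟶ Ψ) :
    Dom.curryEquiv Ξ' Φ Ψ ((f ▷ Φ) ≫ g) = f ≫ Dom.curryEquiv Ξ Φ Ψ g := by
  refine Eq.trans (congrArg Dom.lamEquiv ?_) (Dom.lamEquiv_comp f _)
  simp [Iso.homCongr, whisker_exchange_assoc]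



/-! ### Presheaves -/

/-- Presheaves on the term model. -/
abbrev Psh : Type 1 := Domᵒᵖ ⥤ Type

/-- The closed elements of a presheaf: its value at the empty context. -/
abbrev Psh.closed (F : Psh) : Type := F.obj (Opposite.op (𝟙_ Dom))

/-- The comonad `♭`: the constant presheaf of the closed elements. -/
def Psh.flat (F : Psh) : Psh := (Functor.const Domᵒᵖ).obj F.closed

/-- A closed element as a section of `F` in any context: the inclusion of `♭F` in `F`. -/
def Psh.ofClosed {F : Psh} (G : Psh) (x : F.closed) : G ⟶ F where
  app Φ := ↾fun _ => F.map (toUnit Φ.unop).op x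
  naturality Φ Ψ δ := by
    ext y
    have h : F.map (toUnit Ψ.unop).op = F.map (toUnit Φ.unop).op ≫ F.map δ := by
      rw [← F.map_comp, ← δ.op_unop, ← op_comp, toUnit_unique (δ.unop ≫ toUnit Φ.unop)]
    exact ConcreteCategory.congr_hom h x

/-- The denotation of `let box x = s in t`: at each point use `t` for the closed element given by `s`. -/
def Psh.unflat {G F H : Psh} (s : G ⟶ F.flat) (t : F.closed → (G ⟶ H)) : G ⟶ H where
  app Φ := ↾fun y => (t (s.app Φ y)).app Φ y
  naturality Φ Ψ δ := by
    ext y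
    have h : s.app Ψ (G.map δ y) = s.app Φ y := ConcreteCategory.congr_hom (s.naturality δ) y
    have h' := ConcreteCategory.congr_hom ((t (s.app Φ y)).naturality δ) y
    change (t (s.app Ψ (G.map δ y))).app Ψ (G.map δ y) = _
    rw [h]
    exact h'

/-- The closed element denoted by a term without ordinary variables. -/
def Psh.value {F : Psh} (s : 𝟙_ Psh ⟶ F) : F.closed := s.app _ PUnit.unit

/-- The type `Obj`: the constant presheaf of the objects of the term model. -/
def Psh.objs : Psh := (Functor.const Domᵒᵖ).obj Dom

/-- The object denoted by a term of type `Obj` without ordinary variables. -/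
abbrev Psh.object (s : 𝟙_ Psh ⟶ Psh.objs) : Dom := Psh.value s

/-- The decoding `El c`: the presheaf represented by `c`. -/
abbrev Psh.el (c : Dom) : Psh := yoneda.obj c

/-- The function space of presheaves: an element at `Φ` is a family of functions
`F Ψ → G Ψ`, for all `δ : Ψ ⟶ Φ`, that is natural in `δ`. -/
def Psh.fn (F G : Psh) : Psh := F.functorHom G

def Psh.lam {H F G : Psh} (s : F ⊗ H ⟶ G) : H ⟶ F.fn G :=
  (FunctorToTypes.functorHomEquiv F H G).symm s

def Psh.app {H F G : Psh} (s : H ⟶ F.fn G) (t : H ⟶ F) : H ⟶ G :=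
  lift t (𝟙 H) ≫ FunctorToTypes.functorHomEquiv F H G s

/-- The crisp function space `(x :: F) →♭ S x`. As `♭F` is constant, naturality in the argument is
vacuous and the dependent function space `(x : ♭F) → S x` is the pointwise product. -/
def Psh.crispFn (F : Psh) (S : F.closed → Psh) : Psh where
  obj Φ := ∀ x, (S x).obj Φ
  map δ := ↾fun f x => (S x).map δ (f x)

def Psh.crispLam {F H : Psh} {S : F.closed → Psh} (s : ∀ x, H ⟶ S x) : H ⟶ F.crispFn S where
  app Φ := ↾fun y x => (s x).app Φ y
  naturality Φ Ψ δ := by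
    ext y; funext x
    exact ConcreteCategory.congr_hom ((s x).naturality δ) y

def Psh.crispApp {F H : Psh} {S : F.closed → Psh} (s : H ⟶ F.crispFn S) (x : F.closed) :
    H ⟶ S x where
  app Φ := ↾fun y => s.app Φ y x
  naturality Φ Ψ δ := by
    ext y
    exact congrFun (ConcreteCategory.congr_hom (s.naturality δ) y) x

/-! ### Terms for the universe of representables -/

/-- The term `pair`. -/
def El.pair {H : Psh} {c d : Dom} (s : H ⟶ Psh.el c) (t : H ⟶ Psh.el d) : H ⟶ Psh.el (c ⊗ d) where
  app Φ := ↾fun y => lift (s.app Φ y) (t.app Φ y)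
  naturality Φ Ψ δ := by
    ext y
    have h := ConcreteCategory.congr_hom (s.naturality δ) y
    have h' := ConcreteCategory.congr_hom (t.naturality δ) y
    exact (congrArg₂ lift h h').trans (comp_lift _ _ _).symm

/-- Evaluation for the exponential of the term model; it gives the term `arrow-e`. -/
def El.ev (c d : Dom) : Dom.arrow c d ⊗ c ⟶ d := (Dom.curryEquiv _ c d).symm (𝟙 _)

/-- The term `arrow-i`: an element at `Φ` of `El c → El d` is determined by its value at the generic
point of `Φ ⊗ c`, which is a morphism `Φ ⊗ c ⟶ d`. -/
def El.arrowI (c d : Dom) : (Psh.el c).fn (Psh.el d) ⟶ Psh.el (Dom.arrow c d) where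
  app Φ := ↾fun f => Dom.curryEquiv Φ.unop c d
    (f.app (Opposite.op (Φ.unop ⊗ c)) (fst Φ.unop c).op (snd Φ.unop c))
  naturality Φ Ψ δ := by
    ext f
    have h := ConcreteCategory.congr_hom (f.naturality (δ.unop ▷ c).op (fst Φ.unop c).op)
      (snd Φ.unop c)
    refine Eq.trans ?_ (Dom.curryEquiv_comp δ.unop _)
    refine congrArg (Dom.curryEquiv _ c d) ?_
    refine Eq.trans ?_ h
    have e1 : (fst Φ.unop c).op ≫ (δ.unop ▷ c).op = δ ≫ (fst Ψ.unop c).op := by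
      rw [← op_comp, whiskerRight_fst, op_comp]; rfl
    have e2 : (δ.unop ▷ c) ≫ snd Φ.unop c = snd Ψ.unop c := whiskerRight_snd _ _
    change f.app _ (δ ≫ (fst Ψ.unop c).op) (snd Ψ.unop c) =
      f.app _ ((fst Φ.unop c).op ≫ (δ.unop ▷ c).op) ((δ.unop ▷ c) ≫ snd Φ.unop c)
    rw [e1, e2]



/-- A binary operation on objects, applied to terms of type `Obj`. -/
def Psh.objs₂ (f : Dom → Dom → Dom) {H : Psh} (s t : H ⟶ Psh.objs) : H ⟶ Psh.objs where
  app Φ := ↾fun y => f (s.app Φ y) (t.app Φ y)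
  naturality Φ Ψ δ := by
    ext y
    have h : s.app Ψ (H.map δ y) = s.app Φ y := ConcreteCategory.congr_hom (s.naturality δ) y
    have h' : t.app Ψ (H.map δ y) = t.app Φ y := ConcreteCategory.congr_hom (t.naturality δ) y
    change f (s.app Ψ (H.map δ y)) (t.app Ψ (H.map δ y)) = f (s.app Φ y) (t.app Φ y)
    rw [h, h']

/-- The denotation of `box s`. -/
def Psh.boxed {F : Psh} (H : Psh) (s : 𝟙_ Psh ⟶ F) : H ⟶ F.flat :=
  Psh.ofClosed (F := F.flat) H (show F.closed from Psh.value s)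


/-- The object for the type `tm`. -/
abbrev Dom.tm : Dom := .single .tm

/-- The domain constant `app` as a morphism. -/
def El.appC : Dom.tm ⊗ Dom.tm ⟶ Dom.tm :=
  Dom.homMk (Ψ := ⟨[.tm, .tm]⟩)
    (DomSub.single (.app (.app .cApp (.var (.succ .zero))) (.var .zero)))

/-- The domain constant `lam` as a morphism. -/
def El.lamC : Dom.arrow Dom.tm Dom.tm ⟶ Dom.tm :=
  Dom.homMk (Ψ := ⟨[.arr .tm .tm]⟩) (DomSub.single (.app .cLam (.var .zero)))

/-- The projections `snd ∘ fst^k`. -/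
inductive IsProj : {c a : Dom} → (c ⟶ a) → Prop
  | snd (c a : Dom) : IsProj (snd c a)
  | fst {c a : Dom} (d : Dom) {p : c ⟶ a} : IsProj p → IsProj (fst c d ≫ p)

/-- The function `El c → El a` given by composition with `p`, as an element of the function space. -/
def El.const {c a : Dom} (p : c ⟶ a) (Φ : Domᵒᵖ) : ((Psh.el c).fn (Psh.el a)).obj Φ :=
  Functor.HomObj.ofNatTrans (yoneda.map p)

/-- The functions `El c → El a` that are projections. -/
def El.proj (c a : Dom) : Subfunctor ((Psh.el c).fn (Psh.el a)) where
  obj Φ := {f | ∃ p : c ⟶ a, IsProj p ∧ f = El.const p Φ}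
  map := by
    rintro Φ Ψ δ f ⟨p, hp, rfl⟩
    exact ⟨p, hp, rfl⟩

/-- The restricted function space `El c →ᵥ El a`. -/
def Psh.fnV (c a : Dom) : Psh := (El.proj c a).toFunctor

/-- `El c →ᵥ El a` is a subtype of `El c → El a`. -/
def Psh.fnVIncl (c a : Dom) : Psh.fnV c a ⟶ (Psh.el c).fn (Psh.el a) := (El.proj c a).ι

/-- A closed element of `El c → El a` is a morphism `c ⟶ a`. -/
def El.toHom {c a : Dom} (f : ((Psh.el c).fn (Psh.el a)).closed) : c ⟶ a :=
  f.app (Opposite.op c) (toUnit c).op (𝟙 c)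

/-! ### Restricted function space and recursor -/

/-- The graph of the function defined by primitive recursion over domain terms of type `tm` up to
`βη`: case `v` for variables (projections), `a` for applications of `app`, and `l` for applications of
`lam`. A term of none of these forms (such as `x y` for a variable `x : tm → tm`, or a variable whose type
is a product, projected) receives the value of the case `l` at the last variable of the context; the
equations of the recursor leave the value at such terms open. -/
inductive RecGraph {R : Dom → Type} (v : ∀ (c : Dom) (p : c ⟶ Dom.tm), IsProj p → R c)
    (a : ∀ c : Dom, (c ⟶ Dom.tm) → (c ⟶ Dom.tm) → R c → R c → R c)
    (l : ∀ c : Dom, (c ⊗ Dom.tm ⟶ Dom.tm) → R (c ⊗ Dom.tm) → R c) :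
    (c : Dom) → (c ⟶ Dom.tm) → R c → Prop
  | var {c : Dom} {p : c ⟶ Dom.tm} (hp : IsProj p) : RecGraph v a l c p (v c p hp)
  | app {c : Dom} {m n : c ⟶ Dom.tm} {r s : R c} :
      RecGraph v a l c m r → RecGraph v a l c n s →
      RecGraph v a l c (lift m n ≫ El.appC) (a c m n r s)
  | lam {c : Dom} {m : c ⊗ Dom.tm ⟶ Dom.tm} {r : R (c ⊗ Dom.tm)} :
      RecGraph v a l (c ⊗ Dom.tm) m r →
      RecGraph v a l c (Dom.curryEquiv c _ _ m ≫ El.lamC) (l c m r)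
  | other {c : Dom} {x : c ⟶ Dom.tm} (hv : ¬ IsProj x)
      (ha : ∀ m n, x ≠ lift m n ≫ El.appC) (hl : ∀ m, x ≠ Dom.curryEquiv c _ _ m ≫ El.lamC) :
      RecGraph v a l c x (l c (snd c Dom.tm) (v _ (snd c Dom.tm) (.snd c Dom.tm)))

open Classical in
/-- The function with the graph `RecGraph`. -/
noncomputable def recVal {R : Dom → Type} (v : ∀ (c : Dom) (p : c ⟶ Dom.tm), IsProj p → R c)
    (a : ∀ c : Dom, (c ⟶ Dom.tm) → (c ⟶ Dom.tm) → R c → R c → R c)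
    (l : ∀ c : Dom, (c ⊗ Dom.tm ⟶ Dom.tm) → R (c ⊗ Dom.tm) → R c)
    (c : Dom) (x : c ⟶ Dom.tm) : R c :=
  if h : ∃ r, RecGraph v a l c x r then h.choose
  else l c (snd c Dom.tm) (v _ (snd c Dom.tm) (.snd c Dom.tm))

/-- `El c → El tm`. -/
def Psh.tmIn (c : Dom) : Psh := (Psh.el c).fn (Psh.el Dom.tm)

/-- The type `(c :: Obj) →♭ (x :: ♭(El c →ᵥ El tm)) →♭ A c`. -/
def Psh.varBranch (A : Dom → Psh) : Psh :=
  Psh.objs.crispFn fun c => (Psh.fnV c Dom.tm).flat.crispFn fun _ => A c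

/-- The type `(c :: Obj) →♭ (x y :: ♭(El c → El tm)) →♭ A c →♭ A c →♭ A c`. -/
def Psh.appBranch (A : Dom → Psh) : Psh :=
  Psh.objs.crispFn fun c => (Psh.tmIn c).flat.crispFn fun _ => (Psh.tmIn c).flat.crispFn fun _ =>
    (A c).crispFn fun _ => (A c).crispFn fun _ => A c

/-- The type `(c :: Obj) →♭ (x :: ♭(El (times c tm) → El tm)) →♭ A (times c tm) →♭ A c`. -/
def Psh.lamBranch (A : Dom → Psh) : Psh :=
  Psh.objs.crispFn fun c => (Psh.tmIn (c ⊗ Dom.tm : Dom)).flat.crispFn fun _ =>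
    (A (c ⊗ Dom.tm : Dom)).crispFn fun _ => A c

/-- The recursor on closed elements. -/
noncomputable def Psh.recVal {A : Dom → Psh} (v : (Psh.varBranch A).closed)
    (a : (Psh.appBranch A).closed) (l : (Psh.lamBranch A).closed) (c : Dom)
    (x : (Psh.tmIn c).closed) : (A c).closed :=
  SimpleCocon.recVal (R := fun c => (A c).closed)
    (fun c p hp => v c ⟨El.const p _, p, hp, rfl⟩)
    (fun c m n r s => a c (El.const m _) (El.const n _) r s)
    (fun c m r => l c (El.const m _) r) c (El.toHom x)

/-! ### Internal modal type theory -/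

/-- Raw types and terms of the internal modal type theory. Crisp and ordinary variables have separate
de Bruijn indices: `tyCrispFn`, `crispLam` and the body of `letbox` bind a crisp variable, `lam` binds an
ordinary one. `fst`, `snd` and `arrowE` carry their two arguments of type `Obj`. `tyFnV a b` is
`El a →ᵥ El b`. -/
inductive Exp : Type
  | crispVar (n : ℕ) | ordVar (n : ℕ)
  | tyObj | tyEl (e : Exp) | tyBox (T : Exp) | tyFn (S T : Exp) | tyFnV (a b : Exp)
  | tyCrispFn (S T : Exp)
  | tm | unit | times (a b : Exp) | arrow (a b : Exp)
  | terminal | fst (a b m : Exp) | snd (a b m : Exp) | pair (m n : Exp)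
  | arrowI (m : Exp) | arrowE (a b m n : Exp) | domApp (m n : Exp) | domLam (m : Exp)
  | lam (T m : Exp) | app (m n : Exp)
  | box (m : Exp) | letbox (m n : Exp)
  | crispLam (T m : Exp) | crispApp (m n : Exp)
  | recur (bv ba bl c m : Exp)

/-- Extension of a renaming under a binder. -/
def upRen (r : ℕ → ℕ) : ℕ → ℕ
  | 0 => 0
  | n + 1 => r n + 1

/-- Renaming of the crisp variables. -/
def Exp.cren (r : ℕ → ℕ) : Exp → Exp
  | crispVar n => crispVar (r n)
  | ordVar n => ordVar n
  | tyObj => tyObj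
  | tyEl e => tyEl (e.cren r)
  | tyBox T => tyBox (T.cren r)
  | tyFn S T => tyFn (S.cren r) (T.cren r)
  | tyFnV a b => tyFnV (a.cren r) (b.cren r)
  | tyCrispFn S T => tyCrispFn (S.cren r) (T.cren (upRen r))
  | tm => tm
  | unit => unit
  | times a b => times (a.cren r) (b.cren r)
  | arrow a b => arrow (a.cren r) (b.cren r)
  | terminal => terminal
  | fst a b m => fst (a.cren r) (b.cren r) (m.cren r)
  | snd a b m => snd (a.cren r) (b.cren r) (m.cren r)
  | pair m n => pair (m.cren r) (n.cren r)
  | arrowI m => arrowI (m.cren r)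
  | arrowE a b m n => arrowE (a.cren r) (b.cren r) (m.cren r) (n.cren r)
  | domApp m n => domApp (m.cren r) (n.cren r)
  | domLam m => domLam (m.cren r)
  | lam T m => lam (T.cren r) (m.cren r)
  | app m n => app (m.cren r) (n.cren r)
  | box m => box (m.cren r)
  | letbox m n => letbox (m.cren r) (n.cren (upRen r))
  | crispLam T m => crispLam (T.cren r) (m.cren (upRen r))
  | crispApp m n => crispApp (m.cren r) (n.cren r)
  | recur bv ba bl c m => recur (bv.cren r) (ba.cren r) (bl.cren r) (c.cren r) (m.cren r)

/-- Weakening by a crisp variable. -/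
def Exp.cwk (m : Exp) : Exp := m.cren Nat.succ

/-- The denotation of a crisp context: the set `pts` of tuples of closed values for its variables, and
the types and values of the variables (the most recent first). A crisp context denotes the constant
presheaf on `pts`, so that a type over it amounts to a family of presheaves indexed by `pts`, and a
term amounts to a family of sections. -/
structure CrispCtx : Type 1 where
  pts : Type
  vars : List ((X : pts → Psh) × (∀ k, (X k).closed))

def CrispCtx.nil : CrispCtx := ⟨PUnit, []⟩

/-- Extension of a crisp context by a variable `x :: X`. -/
def CrispCtx.ext (Δ : CrispCtx) (X : Δ.pts → Psh) : CrispCtx where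
  pts := Σ k, (X k).closed
  vars := ⟨fun k => X k.1, fun k => k.2⟩ :: Δ.vars.map fun v => ⟨fun k => v.1 k.1, fun k => v.2 k.1⟩

/-- The presheaf denoted by a context of ordinary variables. -/
def ctxPsh : List Psh → Psh
  | [] => 𝟙_ Psh
  | X :: Θ => X ⊗ ctxPsh Θ

/-- Ordinary variables: the type of the `n`-th variable and the projection to it. -/
inductive OrdVar : (Θ : List Psh) → ℕ → (X : Psh) → (ctxPsh Θ ⟶ X) → Prop
  | zero (Θ : List Psh) (X : Psh) : OrdVar (X :: Θ) 0 X (fst X (ctxPsh Θ))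
  | succ {Θ : List Psh} {n : ℕ} {X : Psh} {s : ctxPsh Θ ⟶ X} (Y : Psh) :
      OrdVar Θ n X s → OrdVar (Y :: Θ) (n + 1) X (snd Y (ctxPsh Θ) ≫ s)

mutual

/-- `HasTy Δ T X`: in the crisp context `Δ`, the expression `T` is a type, and it denotes the family of
presheaves `X`. Types depend on crisp variables only. -/
inductive HasTy : (Δ : CrispCtx) → Exp → (Δ.pts → Psh) → Prop
  | obj {Δ : CrispCtx} : HasTy Δ .tyObj (fun _ => Psh.objs)
  | el {Δ : CrispCtx} {e : Exp} {c : Δ.pts → (𝟙_ Psh ⟶ Psh.objs)} :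
      HasTm Δ (fun _ => []) e (fun _ => Psh.objs) c →
      HasTy Δ (.tyEl e) (fun k => Psh.el (Psh.object (c k)))
  | box {Δ : CrispCtx} {T : Exp} {X : Δ.pts → Psh} :
      HasTy Δ T X → HasTy Δ (.tyBox T) (fun k => (X k).flat)
  | fn {Δ : CrispCtx} {S T : Exp} {X Y : Δ.pts → Psh} :
      HasTy Δ S X → HasTy Δ T Y → HasTy Δ (.tyFn S T) (fun k => (X k).fn (Y k))
  | fnV {Δ : CrispCtx} {a b : Exp} {c d : Δ.pts → (𝟙_ Psh ⟶ Psh.objs)} :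
      HasTm Δ (fun _ => []) a (fun _ => Psh.objs) c →
      HasTm Δ (fun _ => []) b (fun _ => Psh.objs) d →
      HasTy Δ (.tyFnV a b) (fun k => Psh.fnV (Psh.object (c k)) (Psh.object (d k)))
  | crispFn {Δ : CrispCtx} {S T : Exp} {X : Δ.pts → Psh} {Y : (Δ.ext X).pts → Psh} :
      HasTy Δ S X → HasTy (Δ.ext X) T Y →
      HasTy Δ (.tyCrispFn S T) (fun k => (X k).crispFn fun x => Y ⟨k, x⟩)

/-- `HasTm Δ Θ m X s`: the judgement `Δ | Θ ⊢ m : X`, in which `m` denotes the sections `s`. The rules are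
the typing rules of the modal type theory, with the denotation of each term in the presheaf model. `box`, the
argument of a crisp function and the object arguments of constants have no ordinary variables. The rules
`ofFnV` and `toFnV` say that `El c →ᵥ El a` is a subtype of `El c → El a`, and that a function is in it when
its values are projections. -/
inductive HasTm : (Δ : CrispCtx) → (Θ : Δ.pts → List Psh) → Exp → (X : Δ.pts → Psh) →
    (∀ k, ctxPsh (Θ k) ⟶ X k) → Prop
  | crispVar {Δ : CrispCtx} {Θ : Δ.pts → List Psh} {n : ℕ} {X : Δ.pts → Psh}
      {x : ∀ k, (X k).closed} :
      Δ.vars[n]? = some ⟨X, x⟩ →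
      HasTm Δ Θ (.crispVar n) X (fun k => Psh.ofClosed _ (x k))
  | ordVar {Δ : CrispCtx} {Θ : Δ.pts → List Psh} {n : ℕ} {X : Δ.pts → Psh}
      {s : ∀ k, ctxPsh (Θ k) ⟶ X k} :
      (∀ k, OrdVar (Θ k) n (X k) (s k)) → HasTm Δ Θ (.ordVar n) X s
  | box {Δ : CrispCtx} {Θ : Δ.pts → List Psh} {m : Exp} {X : Δ.pts → Psh}
      {s : ∀ k, 𝟙_ Psh ⟶ X k} :
      HasTm Δ (fun _ => []) m X s →
      HasTm Δ Θ (.box m) (fun k => (X k).flat)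
        (fun k => Psh.boxed _ (s k))
  | letbox {Δ : CrispCtx} {Θ : Δ.pts → List Psh} {m n : Exp} {X Y : Δ.pts → Psh}
      {s : ∀ k, ctxPsh (Θ k) ⟶ (X k).flat}
      {t : ∀ k : (Δ.ext X).pts, ctxPsh (Θ k.1) ⟶ Y k.1} :
      HasTm Δ Θ m (fun k => (X k).flat) s →
      HasTm (Δ.ext X) (fun k => Θ k.1) n (fun k => Y k.1) t →
      HasTm Δ Θ (.letbox m n) Y (fun k => Psh.unflat (s k) fun x => t ⟨k, x⟩)
  | lam {Δ : CrispCtx} {Θ : Δ.pts → List Psh} {T m : Exp} {X Y : Δ.pts → Psh}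
      {s : ∀ k, X k ⊗ ctxPsh (Θ k) ⟶ Y k} :
      HasTy Δ T X → HasTm Δ (fun k => X k :: Θ k) m Y s →
      HasTm Δ Θ (.lam T m) (fun k => (X k).fn (Y k)) (fun k => Psh.lam (s k))
  | app {Δ : CrispCtx} {Θ : Δ.pts → List Psh} {m n : Exp} {X Y : Δ.pts → Psh}
      {s : ∀ k, ctxPsh (Θ k) ⟶ (X k).fn (Y k)} {t : ∀ k, ctxPsh (Θ k) ⟶ X k} :
      HasTm Δ Θ m (fun k => (X k).fn (Y k)) s → HasTm Δ Θ n X t →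
      HasTm Δ Θ (.app m n) Y (fun k => Psh.app (s k) (t k))
  | crispLam {Δ : CrispCtx} {Θ : Δ.pts → List Psh} {T m : Exp} {X : Δ.pts → Psh}
      {Y : (Δ.ext X).pts → Psh} {s : ∀ k : (Δ.ext X).pts, ctxPsh (Θ k.1) ⟶ Y k} :
      HasTy Δ T X → HasTm (Δ.ext X) (fun k => Θ k.1) m Y s →
      HasTm Δ Θ (.crispLam T m) (fun k => (X k).crispFn fun x => Y ⟨k, x⟩)
        (fun k => Psh.crispLam fun x => s ⟨k, x⟩)
  | crispApp {Δ : CrispCtx} {Θ : Δ.pts → List Psh} {m n : Exp} {X : Δ.pts → Psh}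
      {Y : (Δ.ext X).pts → Psh} {s : ∀ k, ctxPsh (Θ k) ⟶ (X k).crispFn fun x => Y ⟨k, x⟩}
      {t : ∀ k, 𝟙_ Psh ⟶ X k} :
      HasTm Δ Θ m (fun k => (X k).crispFn fun x => Y ⟨k, x⟩) s →
      HasTm Δ (fun _ => []) n X t →
      HasTm Δ Θ (.crispApp m n) (fun k => Y ⟨k, Psh.value (t k)⟩)
        (fun k => Psh.crispApp (s k) (Psh.value (t k)))
  | tm {Δ : CrispCtx} {Θ : Δ.pts → List Psh} :
      HasTm Δ Θ .tm (fun _ => Psh.objs) (fun _ => Psh.ofClosed (F := Psh.objs) _ Dom.tm)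
  | unit {Δ : CrispCtx} {Θ : Δ.pts → List Psh} :
      HasTm Δ Θ .unit (fun _ => Psh.objs) (fun _ => Psh.ofClosed (F := Psh.objs) _ (𝟙_ Dom))
  | times {Δ : CrispCtx} {Θ : Δ.pts → List Psh} {a b : Exp}
      {s t : ∀ k, ctxPsh (Θ k) ⟶ Psh.objs} :
      HasTm Δ Θ a (fun _ => Psh.objs) s → HasTm Δ Θ b (fun _ => Psh.objs) t →
      HasTm Δ Θ (.times a b) (fun _ => Psh.objs)
        (fun k => Psh.objs₂ (fun c d => c ⊗ d) (s k) (t k))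
  | arrow {Δ : CrispCtx} {Θ : Δ.pts → List Psh} {a b : Exp}
      {s t : ∀ k, ctxPsh (Θ k) ⟶ Psh.objs} :
      HasTm Δ Θ a (fun _ => Psh.objs) s → HasTm Δ Θ b (fun _ => Psh.objs) t →
      HasTm Δ Θ (.arrow a b) (fun _ => Psh.objs) (fun k => Psh.objs₂ Dom.arrow (s k) (t k))
  | terminal {Δ : CrispCtx} {Θ : Δ.pts → List Psh} :
      HasTm Δ Θ .terminal (fun _ => Psh.el (𝟙_ Dom))
        (fun _ => Psh.ofClosed (F := Psh.el (𝟙_ Dom)) _ (𝟙 (𝟙_ Dom)))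
  | fst {Δ : CrispCtx} {Θ : Δ.pts → List Psh} {a b m : Exp}
      {c d : Δ.pts → (𝟙_ Psh ⟶ Psh.objs)}
      {s : ∀ k, ctxPsh (Θ k) ⟶ Psh.el (Psh.object (c k) ⊗ Psh.object (d k))} :
      HasTm Δ (fun _ => []) a (fun _ => Psh.objs) c →
      HasTm Δ (fun _ => []) b (fun _ => Psh.objs) d →
      HasTm Δ Θ m (fun k => Psh.el (Psh.object (c k) ⊗ Psh.object (d k))) s →
      HasTm Δ Θ (.fst a b m) (fun k => Psh.el (Psh.object (c k)))
        (fun k => s k ≫ yoneda.map (fst (Psh.object (c k)) (Psh.object (d k))))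
  | snd {Δ : CrispCtx} {Θ : Δ.pts → List Psh} {a b m : Exp}
      {c d : Δ.pts → (𝟙_ Psh ⟶ Psh.objs)}
      {s : ∀ k, ctxPsh (Θ k) ⟶ Psh.el (Psh.object (c k) ⊗ Psh.object (d k))} :
      HasTm Δ (fun _ => []) a (fun _ => Psh.objs) c →
      HasTm Δ (fun _ => []) b (fun _ => Psh.objs) d →
      HasTm Δ Θ m (fun k => Psh.el (Psh.object (c k) ⊗ Psh.object (d k))) s →
      HasTm Δ Θ (.snd a b m) (fun k => Psh.el (Psh.object (d k)))
        (fun k => s k ≫ yoneda.map (snd (Psh.object (c k)) (Psh.object (d k))))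
  | pair {Δ : CrispCtx} {Θ : Δ.pts → List Psh} {m n : Exp} {c d : Δ.pts → Dom}
      {s : ∀ k, ctxPsh (Θ k) ⟶ Psh.el (c k)} {t : ∀ k, ctxPsh (Θ k) ⟶ Psh.el (d k)} :
      HasTm Δ Θ m (fun k => Psh.el (c k)) s → HasTm Δ Θ n (fun k => Psh.el (d k)) t →
      HasTm Δ Θ (.pair m n) (fun k => Psh.el (c k ⊗ d k)) (fun k => El.pair (s k) (t k))
  | arrowI {Δ : CrispCtx} {Θ : Δ.pts → List Psh} {m : Exp} {c d : Δ.pts → Dom}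
      {s : ∀ k, ctxPsh (Θ k) ⟶ (Psh.el (c k)).fn (Psh.el (d k))} :
      HasTm Δ Θ m (fun k => (Psh.el (c k)).fn (Psh.el (d k))) s →
      HasTm Δ Θ (.arrowI m) (fun k => Psh.el (Dom.arrow (c k) (d k)))
        (fun k => s k ≫ El.arrowI (c k) (d k))
  | arrowE {Δ : CrispCtx} {Θ : Δ.pts → List Psh} {a b m n : Exp}
      {c d : Δ.pts → (𝟙_ Psh ⟶ Psh.objs)}
      {s : ∀ k, ctxPsh (Θ k) ⟶ Psh.el (Dom.arrow (Psh.object (c k)) (Psh.object (d k)))}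
      {t : ∀ k, ctxPsh (Θ k) ⟶ Psh.el (Psh.object (c k))} :
      HasTm Δ (fun _ => []) a (fun _ => Psh.objs) c →
      HasTm Δ (fun _ => []) b (fun _ => Psh.objs) d →
      HasTm Δ Θ m (fun k => Psh.el (Dom.arrow (Psh.object (c k)) (Psh.object (d k)))) s →
      HasTm Δ Θ n (fun k => Psh.el (Psh.object (c k))) t →
      HasTm Δ Θ (.arrowE a b m n) (fun k => Psh.el (Psh.object (d k)))
        (fun k => El.pair (s k) (t k) ≫ yoneda.map (El.ev (Psh.object (c k)) (Psh.object (d k))))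
  | domApp {Δ : CrispCtx} {Θ : Δ.pts → List Psh} {m n : Exp}
      {s t : ∀ k, ctxPsh (Θ k) ⟶ Psh.el Dom.tm} :
      HasTm Δ Θ m (fun _ => Psh.el Dom.tm) s → HasTm Δ Θ n (fun _ => Psh.el Dom.tm) t →
      HasTm Δ Θ (.domApp m n) (fun _ => Psh.el Dom.tm)
        (fun k => El.pair (s k) (t k) ≫ yoneda.map El.appC)
  | domLam {Δ : CrispCtx} {Θ : Δ.pts → List Psh} {m : Exp}
      {s : ∀ k, ctxPsh (Θ k) ⟶ (Psh.el Dom.tm).fn (Psh.el Dom.tm)} :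
      HasTm Δ Θ m (fun _ => (Psh.el Dom.tm).fn (Psh.el Dom.tm)) s →
      HasTm Δ Θ (.domLam m) (fun _ => Psh.el Dom.tm)
        (fun k => s k ≫ El.arrowI Dom.tm Dom.tm ≫ yoneda.map El.lamC)
  | ofFnV {Δ : CrispCtx} {Θ : Δ.pts → List Psh} {m : Exp} {c a : Δ.pts → Dom}
      {s : ∀ k, ctxPsh (Θ k) ⟶ Psh.fnV (c k) (a k)} :
      HasTm Δ Θ m (fun k => Psh.fnV (c k) (a k)) s →
      HasTm Δ Θ m (fun k => (Psh.el (c k)).fn (Psh.el (a k)))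
        (fun k => s k ≫ Psh.fnVIncl (c k) (a k))
  | toFnV {Δ : CrispCtx} {Θ : Δ.pts → List Psh} {m : Exp} {c a : Δ.pts → Dom}
      {s : ∀ k, ctxPsh (Θ k) ⟶ Psh.fnV (c k) (a k)} :
      HasTm Δ Θ m (fun k => (Psh.el (c k)).fn (Psh.el (a k)))
        (fun k => s k ≫ Psh.fnVIncl (c k) (a k)) →
      HasTm Δ Θ m (fun k => Psh.fnV (c k) (a k)) s
  | recur {Δ : CrispCtx} {Θ : Δ.pts → List Psh} {bv ba bl e m : Exp} {A : Δ.pts → Dom → Psh}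
      {v : ∀ k, 𝟙_ Psh ⟶ Psh.varBranch (A k)} {a : ∀ k, 𝟙_ Psh ⟶ Psh.appBranch (A k)}
      {l : ∀ k, 𝟙_ Psh ⟶ Psh.lamBranch (A k)} {c : Δ.pts → (𝟙_ Psh ⟶ Psh.objs)}
      {s : ∀ k, ctxPsh (Θ k) ⟶ (Psh.tmIn (Psh.object (c k))).flat} :
      HasTm Δ (fun _ => []) bv (fun k => Psh.varBranch (A k)) v →
      HasTm Δ (fun _ => []) ba (fun k => Psh.appBranch (A k)) a →
      HasTm Δ (fun _ => []) bl (fun k => Psh.lamBranch (A k)) l →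
      HasTm Δ (fun _ => []) e (fun _ => Psh.objs) c →
      HasTm Δ Θ m (fun k => (Psh.tmIn (Psh.object (c k))).flat) s →
      HasTm Δ Θ (.recur bv ba bl e m) (fun k => A k (Psh.object (c k)))
        (fun k => Psh.unflat (s k) fun x => Psh.ofClosed _
          (Psh.recVal (Psh.value (v k)) (Psh.value (a k)) (Psh.value (l k)) _ x))

end

/-- A list of type expressions is a well-formed crisp context, with denotation `Δ`. -/
inductive IsCrispCtx : List Exp → CrispCtx → Prop
  | nil : IsCrispCtx [] .nil
  | cons {Γ : List Exp} {Δ : CrispCtx} {T : Exp} {X : Δ.pts → Psh} :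
      IsCrispCtx Γ Δ → HasTy Δ T X → IsCrispCtx (T :: Γ) (Δ.ext X)

/-- The judgement `Γ | · ⊢ m : T`, with no ordinary variable. -/
def Derivable (Γ : List Exp) (m T : Exp) : Prop :=
  ∃ (Δ : CrispCtx) (X : Δ.pts → Psh) (s : ∀ k, 𝟙_ Psh ⟶ X k),
    IsCrispCtx Γ Δ ∧ HasTy Δ T X ∧ HasTm Δ (fun _ => []) m X s


/-! ### Simply typed Cocon -/

/-- Domain-level types. -/
inductive CoTy : Type
  | tm
  | arr (A B : CoTy)

/-- Domain-level contexts `·`, `ψ`, `Ψ, x:A`; a context variable is an index into the computation context. -/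
inductive DCtx : Type
  | nil
  | ctxVar (n : ℕ)
  | snoc (Ψ : DCtx) (A : CoTy)

/-- Erased domain-level contexts. -/
inductive ECtx : Type
  | nil
  | ctxVar (n : ℕ)
  | snoc (E : ECtx)

def DCtx.erase : DCtx → ECtx
  | nil => .nil
  | ctxVar n => .ctxVar n
  | snoc Ψ _ => .snoc Ψ.erase

/-- `Ψ` extended by a list of declarations. -/
def DCtx.append (Ψ : DCtx) : List CoTy → DCtx
  | [] => Ψ
  | A :: As => .snoc (Ψ.append As) A

/-- Contextual types `Ψ ⊢ A` (`tm`) and `Ψ ⊢ᵥ A` (`var`). -/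
inductive CtxTy : Type
  | tm (Ψ : DCtx) (A : CoTy)
  | var (Ψ : DCtx) (A : CoTy)

/-- Computation types: `[T]`, `(y : τ₁) ⇒ τ₂` and `(y : ctx) ⇒ τ₂`. Both function types bind `y` in `τ₂`. -/
inductive Ty : Type
  | box (T : CtxTy)
  | arr (τ₁ τ₂ : Ty)
  | arrCtx (τ₂ : Ty)

/-- Declarations of a computation context, and domains of discourse: a type, or `ctx`. -/
inductive Decl : Type
  | ty (τ : Ty)
  | ctx

mutual

/-- Domain-level terms. `var` is a domain variable, an index into the domain context. -/
inductive DTm : Type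
  | lam (M : DTm)
  | app (M N : DTm)
  | var (n : ℕ)
  | cLam
  | cApp
  | unbox (t : Tm) (σ : DSub)

/-- Domain-level substitutions `·`, `wk_Ψ` and `σ, M`. -/
inductive DSub : Type
  | nil
  | wk (E : ECtx)
  | snoc (σ : DSub) (M : DTm)

/-- Contextual objects: a term with an erased domain context. -/
inductive CtxObj : Type
  | mk (E : ECtx) (M : DTm)

/-- Computation terms. `recur I bv ba bl Ψ t` is the recursor with the invariant `I` and the branches
`ψ, p ↦ bv`, `ψ, m, n, f_m, f_n ↦ ba` and `φ, m, f_m ↦ bl`; the branches bind the listed variables. `fn` is the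
abstraction over a term or a context, `app` and `appCtx` are the application to a term and to a context. -/
inductive Tm : Type
  | var (n : ℕ)
  | box (C : CtxObj)
  | recur (I : Ty) (bv ba bl : Tm) (Ψ : DCtx) (t : Tm)
  | fn (t : Tm)
  | app (t s : Tm)
  | appCtx (t : Tm) (Ψ : DCtx)

end

/-- Substitution of domain contexts for context variables. -/
def DCtx.subst (θ : ℕ → DCtx) : DCtx → DCtx
  | nil => nil
  | ctxVar n => θ n
  | snoc Ψ A => snoc (Ψ.subst θ) A

def CtxTy.subst (θ : ℕ → DCtx) : CtxTy → CtxTy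
  | tm Ψ A => tm (Ψ.subst θ) A
  | var Ψ A => var (Ψ.subst θ) A

/-- Extension of a substitution under a binder. -/
def upSubst (θ : ℕ → DCtx) : ℕ → DCtx
  | 0 => .ctxVar 0
  | n + 1 => (θ n).subst fun i => .ctxVar (i + 1)

def Ty.subst (θ : ℕ → DCtx) : Ty → Ty
  | box T => box (T.subst θ)
  | arr τ₁ τ₂ => arr (τ₁.subst θ) (τ₂.subst (upSubst θ))
  | arrCtx τ₂ => arrCtx (τ₂.subst (upSubst θ))

/-- Weakening of a type by `k` variables. -/
def Ty.shift (k : ℕ) (τ : Ty) : Ty := τ.subst fun i => .ctxVar (i + k)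

/-- `[Ψ/ψ]τ`, for the last variable `ψ`. -/
def Ty.inst (Ψ : DCtx) (τ : Ty) : Ty :=
  τ.subst fun
    | 0 => Ψ
    | i + 1 => .ctxVar i

/-- Removal of the last variable when it is a term variable; a term variable does not occur in types,
so that the context put for it plays no role. -/
def Ty.lower (τ : Ty) : Ty := τ.inst .nil

def Decl.shift : Decl → Decl
  | ty τ => ty (τ.shift 1)
  | ctx => ctx

/-- `y : D ∈ Γ`; the declaration is weakened to the whole context. -/
inductive Lookup : List Decl → ℕ → Decl → Prop
  | zero (Γ : List Decl) (D : Decl) : Lookup (D :: Γ) 0 D.shift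
  | succ {Γ : List Decl} {n : ℕ} {D : Decl} (D' : Decl) :
      Lookup Γ n D → Lookup (D' :: Γ) (n + 1) D.shift

/-- `Γ ⊢ Ψ : ctx`. -/
inductive WfDCtx (Γ : List Decl) : DCtx → Prop
  | nil : WfDCtx Γ .nil
  | ctxVar {n : ℕ} : Lookup Γ n .ctx → WfDCtx Γ (.ctxVar n)
  | snoc {Ψ : DCtx} (A : CoTy) : WfDCtx Γ Ψ → WfDCtx Γ (.snoc Ψ A)

/-- `Γ ⊢ τ : type`. -/
inductive WfTy : List Decl → Ty → Prop
  | boxTm {Γ : List Decl} {Ψ : DCtx} (A : CoTy) : WfDCtx Γ Ψ → WfTy Γ (.box (.tm Ψ A))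
  | boxVar {Γ : List Decl} {Ψ : DCtx} (A : CoTy) : WfDCtx Γ Ψ → WfTy Γ (.box (.var Ψ A))
  | arr {Γ : List Decl} {τ₁ τ₂ : Ty} :
      WfTy Γ τ₁ → WfTy (.ty τ₁ :: Γ) τ₂ → WfTy Γ (.arr τ₁ τ₂)
  | arrCtx {Γ : List Decl} {τ₂ : Ty} : WfTy (.ctx :: Γ) τ₂ → WfTy Γ (.arrCtx τ₂)

/-- `⊢ Γ`. -/
inductive WfCtx : List Decl → Prop
  | nil : WfCtx []
  | ty {Γ : List Decl} {τ : Ty} : WfCtx Γ → WfTy Γ τ → WfCtx (.ty τ :: Γ)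
  | ctx {Γ : List Decl} : WfCtx Γ → WfCtx (.ctx :: Γ)

/-- `x : A ∈ Ψ`. -/
inductive DLookup : DCtx → ℕ → CoTy → Prop
  | zero (Ψ : DCtx) (A : CoTy) : DLookup (.snoc Ψ A) 0 A
  | succ {Ψ : DCtx} {n : ℕ} {A : CoTy} (B : CoTy) :
      DLookup Ψ n A → DLookup (.snoc Ψ B) (n + 1) A

/-- The invariant `(ψ : ctx) ⇒ (y : [ψ ⊢ tm]) ⇒ τ` of the recursor. `τ` depends on `ψ` only. -/
def recInv (τ : Ty) : Ty := .arrCtx (.arr (.box (.tm (.ctxVar 0) .tm)) (τ.shift 1))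

mutual

/-- Derivations of `Γ ; Ψ ⊢ M : A`. -/
inductive DTmD : List Decl → DCtx → DTm → CoTy → Type
  | var {Γ : List Decl} {Ψ : DCtx} {n : ℕ} {A : CoTy} :
      WfDCtx Γ Ψ → DLookup Ψ n A → DTmD Γ Ψ (.var n) A
  | cLam {Γ : List Decl} {Ψ : DCtx} :
      WfDCtx Γ Ψ → DTmD Γ Ψ .cLam (.arr (.arr .tm .tm) .tm)
  | cApp {Γ : List Decl} {Ψ : DCtx} :
      WfDCtx Γ Ψ → DTmD Γ Ψ .cApp (.arr .tm (.arr .tm .tm))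
  | app {Γ : List Decl} {Ψ : DCtx} {M N : DTm} {A B : CoTy} :
      DTmD Γ Ψ M (.arr A B) → DTmD Γ Ψ N A → DTmD Γ Ψ (.app M N) B
  | lam {Γ : List Decl} {Ψ : DCtx} {M : DTm} {A B : CoTy} :
      DTmD Γ (.snoc Ψ A) M B → DTmD Γ Ψ (.lam M) (.arr A B)
  | unbox {Γ : List Decl} {Ψ Φ : DCtx} {t : Tm} {σ : DSub} {A : CoTy} :
      TmD Γ t (.box (.tm Φ A)) → DSubD Γ Ψ σ Φ → DTmD Γ Ψ (.unbox t σ) A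
  | unboxVar {Γ : List Decl} {Ψ Φ : DCtx} {t : Tm} {σ : DSub} {A : CoTy} :
      TmD Γ t (.box (.var Φ A)) → DSubD Γ Ψ σ Φ → DTmD Γ Ψ (.unbox t σ) A

/-- Derivations of `Γ ; Ψ ⊢ σ : Φ`, for a substitution `σ` for the variables of `Φ` by terms over `Ψ`. -/
inductive DSubD : List Decl → DCtx → DSub → DCtx → Type
  | wk {Γ : List Decl} {Ψ : DCtx} (As : List CoTy) :
      WfDCtx Γ (Ψ.append As) → DSubD Γ (Ψ.append As) (.wk Ψ.erase) Ψ
  | nil {Γ : List Decl} {Φ : DCtx} : WfDCtx Γ Φ → DSubD Γ Φ .nil .nil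
  | snoc {Γ : List Decl} {Φ Ψ : DCtx} {σ : DSub} {M : DTm} {A : CoTy} :
      DSubD Γ Φ σ Ψ → DTmD Γ Φ M A → DSubD Γ Φ (.snoc σ M) (.snoc Ψ A)

/-- Derivations of `Γ ⊢ C : T`. -/
inductive CtxObjD : List Decl → CtxObj → CtxTy → Type
  | tm {Γ : List Decl} {Ψ : DCtx} {M : DTm} {A : CoTy} :
      DTmD Γ Ψ M A → CtxObjD Γ (.mk Ψ.erase M) (.tm Ψ A)
  | var {Γ : List Decl} {Ψ : DCtx} {n : ℕ} {A : CoTy} :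
      WfDCtx Γ Ψ → DLookup Ψ n A → CtxObjD Γ (.mk Ψ.erase (.var n)) (.var Ψ A)
  | unboxVar {Γ : List Decl} {Ψ Φ : DCtx} {n : ℕ} {E : ECtx} {A : CoTy} :
      Lookup Γ n (.ty (.box (.var Φ A))) → DSubD Γ Ψ (.wk E) Φ →
      CtxObjD Γ (.mk Ψ.erase (.unbox (.var n) (.wk E))) (.var Ψ A)

/-- Derivations of `Γ ⊢ t : τ`. -/
inductive TmD : List Decl → Tm → Ty → Type
  | var {Γ : List Decl} {n : ℕ} {τ : Ty} : Lookup Γ n (.ty τ) → TmD Γ (.var n) τ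
  | box {Γ : List Decl} {C : CtxObj} {T : CtxTy} : CtxObjD Γ C T → TmD Γ (.box C) (.box T)
  | app {Γ : List Decl} {t s : Tm} {τ₁ τ₂ : Ty} :
      TmD Γ t (.arr τ₁ τ₂) → TmD Γ s τ₁ → TmD Γ (.app t s) τ₂.lower
  | appCtx {Γ : List Decl} {t : Tm} {Ψ : DCtx} {τ₂ : Ty} :
      TmD Γ t (.arrCtx τ₂) → WfDCtx Γ Ψ → TmD Γ (.appCtx t Ψ) (τ₂.inst Ψ)
  | fn {Γ : List Decl} {t : Tm} {τ₁ τ₂ : Ty} :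
      TmD (.ty τ₁ :: Γ) t τ₂ → WfTy Γ (.arr τ₁ τ₂) → TmD Γ (.fn t) (.arr τ₁ τ₂)
  | fnCtx {Γ : List Decl} {t : Tm} {τ₂ : Ty} :
      TmD (.ctx :: Γ) t τ₂ → WfTy Γ (.arrCtx τ₂) → TmD Γ (.fn t) (.arrCtx τ₂)
  | recur {Γ : List Decl} {bv ba bl t : Tm} {Ψ : DCtx} {τ : Ty} :
      TmD Γ t (.box (.tm Ψ .tm)) →
      WfTy Γ (recInv τ) →
      TmD (.ty (.box (.var (.ctxVar 0) .tm)) :: .ctx :: Γ) bv (τ.shift 1) →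
      TmD (.ty (τ.shift 3) :: .ty (τ.shift 2) ::
        .ty (.box (.tm (.ctxVar 1) .tm)) :: .ty (.box (.tm (.ctxVar 0) .tm)) :: .ctx :: Γ)
        ba (τ.shift 4) →
      TmD (.ty (τ.subst fun
            | 0 => .snoc (.ctxVar 1) .tm
            | i + 1 => .ctxVar (i + 2)) ::
          .ty (.box (.tm (.snoc (.ctxVar 0) .tm) .tm)) :: .ctx :: Γ)
        bl (τ.shift 2) →
      TmD Γ (.recur (recInv τ) bv ba bl Ψ t) (τ.inst Ψ)

end

/-! ### Interpretation -/

/-- Domain types as terms of type `Obj`. -/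
def CoTy.interp : CoTy → Exp
  | tm => .tm
  | arr A B => .arrow A.interp B.interp

/-- Domain contexts as terms of type `Obj`. -/
def DCtx.interp : DCtx → Exp
  | nil => .unit
  | ctxVar n => .crispVar n
  | snoc Ψ A => .times Ψ.interp A.interp

def CtxTy.interp : CtxTy → Exp
  | tm Ψ A => .tyFn (.tyEl Ψ.interp) (.tyEl A.interp)
  | var Ψ A => .tyFnV Ψ.interp A.interp

def Ty.interp : Ty → Exp
  | box T => .tyBox T.interp
  | arr τ₁ τ₂ => .tyCrispFn τ₁.interp τ₂.interp
  | arrCtx τ₂ => .tyCrispFn .tyObj τ₂.interp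

def Decl.interp : Decl → Exp
  | ty τ => τ.interp
  | ctx => .tyObj

def interpCtx (Γ : List Decl) : List Exp := Γ.map Decl.interp

/-- `fstPow Ψ n m` is `fst^n m`, for `m : El Ψ`. -/
def DCtx.fstPow : DCtx → ℕ → Exp → Exp
  | snoc Ψ A, n + 1, m => Ψ.fstPow n (.fst Ψ.interp A.interp m)
  | _, _, m => m

/-- `proj Ψ n m` is `snd (fst^n m)`, for `m : El Ψ`. -/
def DCtx.proj : DCtx → ℕ → Exp → Exp
  | snoc Ψ A, 0, m => .snd Ψ.interp A.interp m
  | snoc Ψ A, n + 1, m => Ψ.proj n (.fst Ψ.interp A.interp m)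
  | _, _, m => m

/-- The domain variable `n` of `Ψ`: `λ u : El Ψ. snd (fst^n u)`. -/
def interpVar (Ψ : DCtx) (n : ℕ) : Exp := .lam (.tyEl Ψ.interp) (Ψ.proj n (.ordVar 0))

/-- `let box x = e₁ in λ u : El Ψ. x (e₂ u)`. -/
def interpUnbox (Ψ : DCtx) (e₁ e₂ : Exp) : Exp :=
  .letbox e₁ (.lam (.tyEl Ψ.interp.cwk) (.app (.crispVar 0) (.app e₂.cwk (.ordVar 0))))

mutual

/-- The interpretation of domain terms. -/
def DTmD.interp {Γ : List Decl} {Ψ : DCtx} {M : DTm} {A : CoTy} : DTmD Γ Ψ M A → Exp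
  | .var (n := n) _ _ => interpVar Ψ n
  | .cLam _ =>
      .lam (.tyEl Ψ.interp) (.arrowI (.lam (.tyEl (.arrow .tm .tm))
        (.domLam (.lam (.tyEl .tm) (.arrowE .tm .tm (.ordVar 1) (.ordVar 0))))))
  | .cApp _ =>
      .lam (.tyEl Ψ.interp) (.arrowI (.lam (.tyEl .tm)
        (.arrowI (.lam (.tyEl .tm) (.domApp (.ordVar 1) (.ordVar 0))))))
  | .app (A := A) (B := B) d₁ d₂ =>
      .lam (.tyEl Ψ.interp)
        (.arrowE A.interp B.interp (.app d₁.interp (.ordVar 0)) (.app d₂.interp (.ordVar 0)))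
  | .lam (A := A) d =>
      .lam (.tyEl Ψ.interp) (.arrowI (.lam (.tyEl A.interp)
        (.app d.interp (.pair (.ordVar 1) (.ordVar 0)))))
  | .unbox d₁ d₂ => interpUnbox Ψ d₁.interp d₂.interp
  | .unboxVar d₁ d₂ => interpUnbox Ψ d₁.interp d₂.interp

/-- The interpretation of domain substitutions. -/
def DSubD.interp {Γ : List Decl} {Ψ : DCtx} {σ : DSub} {Φ : DCtx} : DSubD Γ Ψ σ Φ → Exp
  | .wk (Ψ := Φ) As _ => .lam (.tyEl (Φ.append As).interp) ((Φ.append As).fstPow As.length (.ordVar 0))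
  | .nil _ => .lam (.tyEl Ψ.interp) .terminal
  | .snoc d₁ d₂ =>
      .lam (.tyEl Ψ.interp) (.pair (.app d₁.interp (.ordVar 0)) (.app d₂.interp (.ordVar 0)))

/-- The interpretation of contextual objects. -/
def CtxObjD.interp {Γ : List Decl} {C : CtxObj} {T : CtxTy} : CtxObjD Γ C T → Exp
  | .tm d => d.interp
  | .var (Ψ := Ψ) (n := n) _ _ => interpVar Ψ n
  | .unboxVar (Ψ := Ψ) (n := n) _ d => interpUnbox Ψ (.crispVar n) d.interp

/-- The interpretation of computation terms. -/
def TmD.interp {Γ : List Decl} {t : Tm} {τ : Ty} : TmD Γ t τ → Exp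
  | .var (n := n) _ => .crispVar n
  | .box d => .box d.interp
  | .app d₁ d₂ => .crispApp d₁.interp d₂.interp
  | .appCtx (Ψ := Ψ) d _ => .crispApp d.interp Ψ.interp
  | .fn (τ₁ := τ₁) d _ => .crispLam τ₁.interp d.interp
  | .fnCtx d _ => .crispLam .tyObj d.interp
  | .recur (Ψ := Ψ) (τ := τ) d _ dv da dl =>
      .recur
        (.crispLam .tyObj (.crispLam (.tyBox (.tyFnV (.crispVar 0) .tm))
          dv.interp))
        (.crispLam .tyObj
          (.crispLam (.tyBox (.tyFn (.tyEl (.crispVar 0)) (.tyEl .tm)))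
            (.crispLam (.tyBox (.tyFn (.tyEl (.crispVar 1)) (.tyEl .tm)))
              (.crispLam (τ.shift 2).interp (.crispLam (τ.shift 3).interp da.interp)))))
        (.crispLam .tyObj
          (.crispLam (.tyBox (.tyFn (.tyEl (.times (.crispVar 0) .tm)) (.tyEl .tm)))
            (.crispLam (τ.subst fun
                | 0 => .snoc (.ctxVar 1) .tm
                | i + 1 => .ctxVar (i + 2)).interp dl.interp)))
        Ψ.interp d.interp

end

end SimpleCocon

open SimpleCocon

namespace SimpleCocon

/-! ### Renaming of crisp variables in the internal type theory -/

/-- `f` sends the points of `Δ'` to points of `Δ` in such a way that the variable `r n` of `Δ'` denotes the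
variable `n` of `Δ`. -/
def CrispCtx.IsRen (Δ Δ' : CrispCtx) (r : ℕ → ℕ) (f : Δ'.pts → Δ.pts) : Prop :=
  ∀ (n : ℕ) (X : Δ.pts → Psh) (x : ∀ k, (X k).closed), Δ.vars[n]? = some ⟨X, x⟩ →
    Δ'.vars[r n]? = some ⟨fun k => X (f k), fun k => x (f k)⟩

/-- Extension of a map of points under a binder. -/
def CrispCtx.upMap {Δ Δ' : CrispCtx} (f : Δ'.pts → Δ.pts) (X : Δ.pts → Psh) :
    (Δ'.ext fun k => X (f k)).pts → (Δ.ext X).pts := fun k => ⟨f k.1, k.2⟩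

theorem CrispCtx.ext_vars_zero (Δ : CrispCtx) (X : Δ.pts → Psh) :
    (Δ.ext X).vars[0]? = some ⟨fun k => X k.1, fun k => k.2⟩ := rfl

theorem CrispCtx.ext_vars_succ {Δ : CrispCtx} (X : Δ.pts → Psh) (n : ℕ) :
    (Δ.ext X).vars[n + 1]? = Δ.vars[n]?.map fun v => ⟨fun k => v.1 k.1, fun k => v.2 k.1⟩ :=
  List.getElem?_map ..

theorem CrispCtx.ext_vars_succ_of_eq {Δ : CrispCtx} (X : Δ.pts → Psh) {n : ℕ} {Y : Δ.pts → Psh}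
    {y : ∀ k, (Y k).closed} (h : Δ.vars[n]? = some ⟨Y, y⟩) :
    (Δ.ext X).vars[n + 1]? = some ⟨fun k => Y k.1, fun k => y k.1⟩ := by
  rw [CrispCtx.ext_vars_succ, h]; rfl

theorem CrispCtx.IsRen.up {Δ Δ' : CrispCtx} {r : ℕ → ℕ} {f : Δ'.pts → Δ.pts}
    (h : Δ.IsRen Δ' r f) (X : Δ.pts → Psh) :
    (Δ.ext X).IsRen (Δ'.ext fun k => X (f k)) (upRen r) (CrispCtx.upMap f X) := by
  rintro (_ | n) Y y hn
  · rw [CrispCtx.ext_vars_zero] at hn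
    cases hn
    rfl
  · rw [CrispCtx.ext_vars_succ, Option.map_eq_some_iff] at hn
    obtain ⟨⟨Z, z⟩, hZ, hn⟩ := hn
    cases hn
    exact CrispCtx.ext_vars_succ_of_eq _ (h n Z z hZ)

theorem CrispCtx.isRen_succ (Δ : CrispCtx) (X : Δ.pts → Psh) :
    Δ.IsRen (Δ.ext X) Nat.succ Sigma.fst :=
  fun _ _ _ h => CrispCtx.ext_vars_succ_of_eq X h

theorem HasTm.cren {Δ : CrispCtx} {Θ : Δ.pts → List Psh} {m : Exp} {X : Δ.pts → Psh}
    {s : ∀ k, ctxPsh (Θ k) ⟶ X k} (h : HasTm Δ Θ m X s) : ∀ {Δ' : CrispCtx} {r : ℕ → ℕ}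
    {f : Δ'.pts → Δ.pts}, Δ.IsRen Δ' r f →
    HasTm Δ' (fun k => Θ (f k)) (m.cren r) (fun k => X (f k)) (fun k => s (f k)) := by
  refine HasTm.rec
    (motive_1 := fun Δ T X _ => ∀ {Δ' : CrispCtx} {r : ℕ → ℕ} {f : Δ'.pts → Δ.pts},
      Δ.IsRen Δ' r f → HasTy Δ' (T.cren r) (fun k => X (f k)))
    (motive_2 := fun Δ Θ m X s _ => ∀ {Δ' : CrispCtx} {r : ℕ → ℕ} {f : Δ'.pts → Δ.pts},
      Δ.IsRen Δ' r f →
      HasTm Δ' (fun k => Θ (f k)) (m.cren r) (fun k => X (f k)) (fun k => s (f k)))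
    ?obj ?el ?tyBox ?tyFn ?tyFnV ?tyCrispFn ?crispVar ?ordVar ?box ?letbox ?lam ?app ?crispLam
    ?crispApp ?tm ?unit ?times ?arrow ?terminal ?fst ?snd ?pair ?arrowI ?arrowE ?domApp ?domLam
    ?ofFnV ?toFnV ?recur h
  case obj => exact fun _ => .obj
  case el => exact fun _ i _ _ _ hr => .el (i hr)
  case tyBox => exact fun _ i _ _ _ hr => .box (i hr)
  case tyFn => exact fun _ _ i j _ _ _ hr => .fn (i hr) (j hr)
  case tyFnV => exact fun _ _ i j _ _ _ hr => .fnV (i hr) (j hr)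
  case tyCrispFn => exact fun _ _ i j _ _ _ hr => .crispFn (i hr) (j (hr.up _))
  case crispVar => exact fun h _ _ _ hr => .crispVar (hr _ _ _ h)
  case ordVar => exact fun h _ _ _ _ => .ordVar fun k => h _
  case box => exact fun _ i _ _ _ hr => .box (i hr)
  case letbox =>
    intro Δ Θ m n X Y s t _ _ i j Δ' r f hr
    exact .letbox (Θ := fun k => Θ (f k)) (X := fun k => X (f k)) (Y := fun k => Y (f k))
      (s := fun k => s (f k)) (t := fun k => t (CrispCtx.upMap f X k)) (i hr) (j (hr.up X))
  case lam => exact fun _ _ i j _ _ _ hr => .lam (i hr) (j hr)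
  case app => exact fun _ _ i j _ _ _ hr => .app (i hr) (j hr)
  case crispLam =>
    intro Δ Θ T m X Y s _ _ i j Δ' r f hr
    exact .crispLam (Θ := fun k => Θ (f k)) (Y := fun k => Y (CrispCtx.upMap f X k))
      (s := fun k => s (CrispCtx.upMap f X k)) (i hr) (j (hr.up X))
  case crispApp =>
    intro Δ Θ m n X Y s t _ _ i j Δ' r f hr
    exact .crispApp (X := fun k => X (f k)) (Y := fun k => Y (CrispCtx.upMap f X k))
      (s := fun k => s (f k)) (t := fun k => t (f k)) (i hr) (j hr)
  case tm => exact fun _ => .tm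
  case unit => exact fun _ => .unit
  case times => exact fun _ _ i j _ _ _ hr => .times (i hr) (j hr)
  case arrow => exact fun _ _ i j _ _ _ hr => .arrow (i hr) (j hr)
  case terminal => exact fun _ => .terminal
  case fst => exact fun _ _ _ i j l _ _ _ hr => .fst (i hr) (j hr) (l hr)
  case snd => exact fun _ _ _ i j l _ _ _ hr => .snd (i hr) (j hr) (l hr)
  case pair => exact fun _ _ i j _ _ _ hr => .pair (i hr) (j hr)
  case arrowI => exact fun _ i _ _ _ hr => .arrowI (i hr)
  case arrowE => exact fun _ _ _ _ i j l o _ _ _ hr => .arrowE (i hr) (j hr) (l hr) (o hr)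
  case domApp => exact fun _ _ i j _ _ _ hr => .domApp (i hr) (j hr)
  case domLam => exact fun _ i _ _ _ hr => .domLam (i hr)
  case ofFnV => exact fun _ i _ _ _ hr => .ofFnV (i hr)
  case toFnV => exact fun _ i _ _ _ hr => .toFnV (i hr)
  case recur =>
    exact fun _ _ _ _ _ i j l o p _ _ _ hr => .recur (i hr) (j hr) (l hr) (o hr) (p hr)

theorem HasTm.cwk {Δ : CrispCtx} {Θ : Δ.pts → List Psh} {m : Exp} {X : Δ.pts → Psh}
    {s : ∀ k, ctxPsh (Θ k) ⟶ X k} (h : HasTm Δ Θ m X s) (Y : Δ.pts → Psh) :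
    HasTm (Δ.ext Y) (fun k => Θ k.1) m.cwk (fun k => X k.1) (fun k => s k.1) :=
  h.cren (Δ.isRen_succ Y)

/-! ### Syntactic properties of Cocon -/

theorem DCtx.subst_subst (Ψ : DCtx) (θ θ' : ℕ → DCtx) :
    (Ψ.subst θ).subst θ' = Ψ.subst fun n => (θ n).subst θ' := by
  induction Ψ with
  | snoc Ψ A ih => simp [DCtx.subst, ih]
  | _ => rfl

theorem DCtx.subst_ctxVar (Ψ : DCtx) : Ψ.subst .ctxVar = Ψ := by
  induction Ψ with
  | snoc Ψ A ih => simp [DCtx.subst, ih]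
  | _ => rfl

theorem CtxTy.subst_subst (T : CtxTy) (θ θ' : ℕ → DCtx) :
    (T.subst θ).subst θ' = T.subst fun n => (θ n).subst θ' := by
  cases T <;> simp [CtxTy.subst, DCtx.subst_subst]

theorem CtxTy.subst_ctxVar (T : CtxTy) : T.subst .ctxVar = T := by
  cases T <;> simp [CtxTy.subst, DCtx.subst_ctxVar]

theorem upSubst_subst (θ θ' : ℕ → DCtx) :
    (fun n => (upSubst θ n).subst (upSubst θ')) = upSubst fun n => (θ n).subst θ' := by
  funext n
  cases n with
  | zero => rfl
  | succ n => simp only [upSubst, DCtx.subst_subst]; rfl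

theorem upSubst_ctxVar : upSubst .ctxVar = .ctxVar := by
  funext n; cases n <;> rfl

theorem Ty.subst_subst (τ : Ty) : ∀ θ θ' : ℕ → DCtx,
    (τ.subst θ).subst θ' = τ.subst fun n => (θ n).subst θ' := by
  induction τ with
  | box T => intros; simp [Ty.subst, CtxTy.subst_subst]
  | arr τ₁ τ₂ ih ih' => intros; simp [Ty.subst, ih, ih', upSubst_subst]
  | arrCtx τ ih => intros; simp [Ty.subst, ih, upSubst_subst]

theorem Ty.subst_ctxVar (τ : Ty) : τ.subst .ctxVar = τ := by
  induction τ with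
  | box T => simp [Ty.subst, CtxTy.subst_ctxVar]
  | arr τ₁ τ₂ ih ih' => simp [Ty.subst, ih, ih', upSubst_ctxVar]
  | arrCtx τ ih => simp [Ty.subst, ih, upSubst_ctxVar]

theorem Ty.shift_lower (τ : Ty) : (τ.shift 1).lower = τ := by
  rw [Ty.lower, Ty.inst, Ty.shift, Ty.subst_subst]
  exact τ.subst_ctxVar

theorem Decl.shift_eq_ctx {D : Decl} : D.shift = .ctx ↔ D = .ctx := by
  cases D <;> simp [Decl.shift]

theorem Lookup.ctx_zero (Γ : List Decl) : Lookup (.ctx :: Γ) 0 .ctx := .zero Γ .ctx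

theorem Lookup.ctx_succ {Γ : List Decl} {n : ℕ} (D : Decl) (h : Lookup Γ n .ctx) :
    Lookup (D :: Γ) (n + 1) .ctx := h.succ D

theorem Lookup.of_ctx_zero {Γ : List Decl} {D : Decl} (h : Lookup (D :: Γ) 0 .ctx) : D = .ctx := by
  generalize hE : Decl.ctx = E at h
  cases h
  exact (Decl.shift_eq_ctx.1 hE.symm).trans hE

theorem Lookup.of_ctx_succ {Γ : List Decl} {D : Decl} {n : ℕ} (h : Lookup (D :: Γ) (n + 1) .ctx) :
    Lookup Γ n .ctx := by
  generalize hE : Decl.ctx = E at h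
  cases h with
  | succ _ h =>
    rw [Decl.shift_eq_ctx.1 hE.symm] at h
    rwa [← hE]

/-- `θ` is a well-formed substitution over `Γ'` for the context variables of `Γ`. -/
def WfSubst (Γ Γ' : List Decl) (θ : ℕ → DCtx) : Prop :=
  ∀ n, Lookup Γ n .ctx → WfDCtx Γ' (θ n)

theorem WfDCtx.subst {Γ Γ' : List Decl} {Ψ : DCtx} {θ : ℕ → DCtx} (h : WfDCtx Γ Ψ)
    (hθ : WfSubst Γ Γ' θ) : WfDCtx Γ' (Ψ.subst θ) := by
  induction h with
  | nil => exact .nil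
  | ctxVar h => exact hθ _ h
  | snoc A _ ih => exact .snoc A ih

theorem wfSubst_succ (Γ : List Decl) (D : Decl) :
    WfSubst Γ (D :: Γ) fun i => .ctxVar (i + 1) :=
  fun _ h => .ctxVar (h.ctx_succ D)

theorem WfSubst.up {Γ Γ' : List Decl} {θ : ℕ → DCtx} (hθ : WfSubst Γ Γ' θ) {D D' : Decl}
    (hD : D = .ctx → D' = .ctx) : WfSubst (D :: Γ) (D' :: Γ') (upSubst θ) := by
  rintro (_ | n) h
  · obtain rfl := hD h.of_ctx_zero
    exact .ctxVar (.ctx_zero _)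
  · exact (hθ n h.of_ctx_succ).subst (wfSubst_succ Γ' D')

theorem WfTy.subst {Γ : List Decl} {τ : Ty} (h : WfTy Γ τ) : ∀ {Γ' : List Decl} {θ : ℕ → DCtx},
    WfSubst Γ Γ' θ → WfTy Γ' (τ.subst θ) := by
  induction h with
  | boxTm A h => exact fun hθ => .boxTm A (h.subst hθ)
  | boxVar A h => exact fun hθ => .boxVar A (h.subst hθ)
  | arr _ _ ih ih' => exact fun hθ => .arr (ih hθ) (ih' (hθ.up (by simp)))
  | arrCtx _ ih => exact fun hθ => .arrCtx (ih (hθ.up fun _ => rfl))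

theorem WfTy.shift {Γ : List Decl} {τ : Ty} (h : WfTy Γ τ) (Δ : List Decl) :
    WfTy (Δ ++ Γ) (τ.shift Δ.length) := by
  refine h.subst fun n hn => .ctxVar ?_
  induction Δ with
  | nil => exact hn
  | cons D Δ ih => exact ih.ctx_succ D

theorem WfTy.inst {Γ : List Decl} {D : Decl} {τ : Ty} {Ψ : DCtx} (h : WfTy (D :: Γ) τ)
    (hΨ : WfDCtx Γ Ψ) : WfTy Γ (τ.inst Ψ) := by
  refine h.subst ?_
  rintro (_ | n) hn
  · exact hΨ
  · exact .ctxVar hn.of_ctx_succ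

theorem WfTy.of_recInv {Γ : List Decl} {τ : Ty} (h : WfTy Γ (recInv τ)) : WfTy (.ctx :: Γ) τ := by
  obtain _ | _ | _ | ⟨_ | _ | ⟨_, h⟩⟩ := h
  have := h.inst .nil
  rwa [← Ty.lower, Ty.shift_lower] at this

/-- The well-formedness of a declaration. -/
def WfDecl (Γ : List Decl) : Decl → Prop
  | .ty τ => WfTy Γ τ
  | .ctx => True

theorem WfDecl.shift {Γ : List Decl} {D : Decl} (h : WfDecl Γ D) (D' : Decl) :
    WfDecl (D' :: Γ) D.shift := by
  cases D with
  | ty τ => exact WfTy.shift h [D']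
  | ctx => trivial

theorem WfCtx.tail {Γ : List Decl} {D : Decl} (h : WfCtx (D :: Γ)) : WfCtx Γ := by
  cases h <;> assumption

theorem WfCtx.head {Γ : List Decl} {D : Decl} (h : WfCtx (D :: Γ)) : WfDecl Γ D := by
  cases h with
  | ty _ h => exact h
  | ctx _ => trivial

theorem Lookup.wfDecl {Γ : List Decl} {n : ℕ} {D : Decl} (h : Lookup Γ n D) (hΓ : WfCtx Γ) :
    WfDecl Γ D := by
  induction h with
  | zero Γ D => exact hΓ.head.shift D
  | succ D' _ ih => exact (ih hΓ.tail).shift D'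

theorem DSubD.wf {Γ : List Decl} {Ψ : DCtx} {σ : DSub} {Φ : DCtx} :
    DSubD Γ Ψ σ Φ → WfDCtx Γ Ψ ∧ WfDCtx Γ Φ
  | .wk As h => by
    refine ⟨h, ?_⟩
    induction As with
    | nil => exact h
    | cons A As ih => cases h with | snoc _ h => exact ih h
  | .nil h => ⟨h, .nil⟩
  | .snoc (A := A) d _ => ⟨d.wf.1, .snoc A d.wf.2⟩

theorem DTmD.wf {Γ : List Decl} {Ψ : DCtx} {M : DTm} {A : CoTy} : DTmD Γ Ψ M A → WfDCtx Γ Ψ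
  | .var h _ => h
  | .cLam h => h
  | .cApp h => h
  | .app d _ => d.wf
  | .lam d => by cases d.wf; assumption
  | .unbox _ d => d.wf.1
  | .unboxVar _ d => d.wf.1

theorem CtxObjD.wf {Γ : List Decl} {C : CtxObj} {T : CtxTy} : CtxObjD Γ C T → WfTy Γ (.box T)
  | .tm d => .boxTm _ d.wf
  | .var h _ => .boxVar _ h
  | .unboxVar _ d => .boxVar _ d.wf.1

theorem TmD.wf {Γ : List Decl} {t : Tm} {τ : Ty} : TmD Γ t τ → WfCtx Γ → WfTy Γ τ
  | .var h, hΓ => h.wfDecl hΓ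
  | .box d, _ => d.wf
  | .app d _, hΓ => by cases d.wf hΓ with | arr _ h => exact h.inst .nil
  | .appCtx d hΨ, hΓ => by cases d.wf hΓ with | arrCtx h => exact h.inst hΨ
  | .fn _ h, _ => h
  | .fnCtx _ h, _ => h
  | .recur d h _ _ _, hΓ => by cases d.wf hΓ with | boxTm _ hΨ => exact h.of_recInv.inst hΨ

/-! ### Denotations of Cocon types and contexts -/

/-- Extension of an environment by a value for the last variable. -/
def consEnv (c : Dom) (ρ : ℕ → Dom) : ℕ → Dom
  | 0 => c
  | n + 1 => ρ n

def CoTy.den : CoTy → Dom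
  | tm => Dom.tm
  | arr A B => Dom.arrow A.den B.den

def DCtx.den (ρ : ℕ → Dom) : DCtx → Dom
  | nil => 𝟙_ Dom
  | ctxVar n => ρ n
  | snoc Ψ A => Ψ.den ρ ⊗ A.den

def CtxTy.den (ρ : ℕ → Dom) : CtxTy → Psh
  | tm Ψ A => (Psh.el (Ψ.den ρ)).fn (Psh.el A.den)
  | var Ψ A => Psh.fnV (Ψ.den ρ) A.den

/-- The denotation of a computation type, given objects for the context variables. A term variable gets
the value `𝟙_ Dom`, the denotation of the context that `Ty.lower` puts for it. -/
def Ty.den (ρ : ℕ → Dom) : Ty → Psh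
  | box T => (T.den ρ).flat
  | arr τ₁ τ₂ => (τ₁.den ρ).crispFn fun _ => τ₂.den (consEnv (𝟙_ Dom) ρ)
  | arrCtx τ₂ => Psh.objs.crispFn fun c => τ₂.den (consEnv c ρ)

theorem DCtx.den_subst (Ψ : DCtx) (θ : ℕ → DCtx) (ρ : ℕ → Dom) :
    (Ψ.subst θ).den ρ = Ψ.den fun n => (θ n).den ρ := by
  induction Ψ with
  | snoc Ψ A ih => simp [DCtx.subst, DCtx.den, ih]
  | _ => rfl

theorem CtxTy.den_subst (T : CtxTy) (θ : ℕ → DCtx) (ρ : ℕ → Dom) :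
    (T.subst θ).den ρ = T.den fun n => (θ n).den ρ := by
  cases T <;> simp [CtxTy.subst, CtxTy.den, DCtx.den_subst]

theorem den_upSubst (θ : ℕ → DCtx) (c : Dom) (ρ : ℕ → Dom) :
    (fun n => (upSubst θ n).den (consEnv c ρ)) = consEnv c fun n => (θ n).den ρ := by
  funext n
  cases n with
  | zero => rfl
  | succ n => exact DCtx.den_subst _ _ _

theorem Ty.den_subst (τ : Ty) : ∀ (θ : ℕ → DCtx) (ρ : ℕ → Dom),
    (τ.subst θ).den ρ = τ.den fun n => (θ n).den ρ := by
  induction τ with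
  | box T => intros; simp [Ty.subst, Ty.den, CtxTy.den_subst]
  | arr τ₁ τ₂ ih ih' =>
    intro θ ρ
    rw [Ty.subst, Ty.den, Ty.den, ih, ih', den_upSubst]
  | arrCtx τ ih =>
    intro θ ρ
    exact congrArg Psh.objs.crispFn (funext fun c =>
      (ih _ _).trans (congrArg (fun ρ' => τ.den ρ') (den_upSubst θ c ρ)))

theorem Ty.den_shift (τ : Ty) (k : ℕ) (ρ : ℕ → Dom) :
    (τ.shift k).den ρ = τ.den fun n => ρ (n + k) := τ.den_subst _ _

theorem Ty.den_inst (τ : Ty) (Ψ : DCtx) (ρ : ℕ → Dom) :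
    (τ.inst Ψ).den ρ = τ.den (consEnv (Ψ.den ρ) ρ) := by
  rw [Ty.inst, Ty.den_subst]
  congr 1; funext n; cases n <;> rfl

/-- The denotation of a declaration. -/
def Decl.den (ρ : ℕ → Dom) : Decl → Psh
  | ty τ => τ.den ρ
  | ctx => Psh.objs

theorem Decl.den_shift (D : Decl) (ρ : ℕ → Dom) : D.shift.den ρ = D.den fun n => ρ (n + 1) := by
  cases D with
  | ty τ => exact τ.den_shift 1 ρ
  | ctx => rfl

/-- A crisp context together with objects for the context variables. -/
structure EnvCtx : Type 1 where
  crisp : CrispCtx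
  env : crisp.pts → ℕ → Dom

def EnvCtx.extTy (Δ : EnvCtx) (X : Δ.crisp.pts → Psh) : EnvCtx where
  crisp := Δ.crisp.ext X
  env k := consEnv (𝟙_ Dom) (Δ.env k.1)

def EnvCtx.extObj (Δ : EnvCtx) : EnvCtx where
  crisp := Δ.crisp.ext fun _ => Psh.objs
  env k := consEnv k.2 (Δ.env k.1)

/-- The denotation of a computation context. -/
def denCtx : List Decl → EnvCtx
  | [] => ⟨.nil, fun _ _ => 𝟙_ Dom⟩
  | .ty τ :: Γ => (denCtx Γ).extTy fun k => τ.den ((denCtx Γ).env k)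
  | .ctx :: Γ => (denCtx Γ).extObj

/-- The points of the denotation of a computation context. -/
abbrev Pts (Γ : List Decl) : Type := (denCtx Γ).crisp.pts

theorem Lookup.den_ctx {Γ : List Decl} : ∀ {n : ℕ}, Lookup Γ n .ctx →
    (denCtx Γ).crisp.vars[n]? = some ⟨fun _ => Psh.objs, fun k => (denCtx Γ).env k n⟩ := by
  induction Γ with
  | nil => intro n h; cases h
  | cons D Γ ih =>
    rintro (_ | n) h
    · obtain rfl := h.of_ctx_zero
      rfl
    · have := ih h.of_ctx_succ
      cases D <;> exact CrispCtx.ext_vars_succ_of_eq _ this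

theorem Lookup.den {Γ : List Decl} {n : ℕ} {D : Decl} (h : Lookup Γ n D) :
    ∃ x, (denCtx Γ).crisp.vars[n]? = some ⟨fun k => D.den ((denCtx Γ).env k), x⟩ := by
  have cast {Δ : CrispCtx} {n : ℕ} {X Y : Δ.pts → Psh} {x : ∀ k, (X k).closed}
      (h : Δ.vars[n]? = some ⟨X, x⟩) (e : ∀ k, Y k = X k) : ∃ y, Δ.vars[n]? = some ⟨Y, y⟩ := by
    obtain rfl : Y = X := funext e
    exact ⟨x, h⟩
  induction h with
  | zero Γ D =>
    cases D with
    | ty τ => exact cast rfl fun k => Decl.den_shift (.ty τ) _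
    | ctx => exact ⟨_, rfl⟩
  | @succ Γ n D D' _ ih =>
    obtain ⟨x, hx⟩ := ih
    cases D' <;> exact cast (CrispCtx.ext_vars_succ_of_eq _ hx) fun k => Decl.den_shift D _

/-! ### Interpretation of domain types, domain contexts and computation types -/

/-- The section of `Obj` with the given value. -/
abbrev Psh.obj (H : Psh) (c : Dom) : H ⟶ Psh.objs := Psh.ofClosed (F := Psh.objs) H c

theorem CoTy.interp_hasTm (A : CoTy) (Δ : CrispCtx) (Θ : Δ.pts → List Psh) :
    HasTm Δ Θ A.interp (fun _ => Psh.objs) (fun _ => Psh.obj _ A.den) := by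
  induction A with
  | tm => exact .tm
  | arr A B ih ih' => exact .arrow ih ih'

theorem WfDCtx.interp_hasTm {Γ : List Decl} {Ψ : DCtx} (h : WfDCtx Γ Ψ)
    (Θ : Pts Γ → List Psh) :
    HasTm (denCtx Γ).crisp Θ Ψ.interp (fun _ => Psh.objs)
      (fun k => Psh.obj _ (Ψ.den ((denCtx Γ).env k))) := by
  induction h with
  | nil => exact .unit
  | ctxVar h => exact .crispVar h.den_ctx
  | snoc A _ ih => exact .times ih (A.interp_hasTm _ _)

theorem CoTy.interp_hasTy (A : CoTy) (Δ : CrispCtx) :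
    HasTy Δ (.tyEl A.interp) (fun _ => Psh.el A.den) := .el (A.interp_hasTm Δ _)

theorem WfDCtx.interp_hasTy {Γ : List Decl} {Ψ : DCtx} (h : WfDCtx Γ Ψ) :
    HasTy (denCtx Γ).crisp (.tyEl Ψ.interp) (fun k => Psh.el (Ψ.den ((denCtx Γ).env k))) :=
  .el (h.interp_hasTm _)

theorem WfTy.interp_hasTy {Γ : List Decl} {τ : Ty} (h : WfTy Γ τ) :
    HasTy (denCtx Γ).crisp τ.interp (fun k => τ.den ((denCtx Γ).env k)) := by
  induction h with
  | boxTm A h => exact .box (.fn h.interp_hasTy (A.interp_hasTy _))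
  | boxVar A h => exact .box (.fnV (h.interp_hasTm _) (A.interp_hasTm _ _))
  | arr _ _ ih ih' => exact .crispFn ih ih'
  | arrCtx _ ih => exact .crispFn .obj ih

theorem WfCtx.isCrispCtx {Γ : List Decl} (h : WfCtx Γ) :
    IsCrispCtx (interpCtx Γ) (denCtx Γ).crisp := by
  induction h with
  | nil => exact .nil
  | ty _ h ih => exact .cons ih h.interp_hasTy
  | ctx _ ih => exact .cons ih .obj

/-! ### Functions between representables given by morphisms -/

theorem Psh.app_lam {H F G : Psh} (s : F ⊗ H ⟶ G) (t : H ⟶ F) :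
    Psh.app (Psh.lam s) t = lift t (𝟙 H) ≫ s := by
  rw [Psh.app, Psh.lam, Equiv.apply_symm_apply]

/-- The function given by composition with a morphism. -/
def Psh.post (H : Psh) {c d : Dom} (p : c ⟶ d) : H ⟶ (Psh.el c).fn (Psh.el d) :=
  Psh.lam (fst (Psh.el c) H ≫ yoneda.map p)

theorem Psh.app_post {H : Psh} {c d : Dom} (p : c ⟶ d) (t : H ⟶ Psh.el c) :
    Psh.app (Psh.post H p) t = t ≫ yoneda.map p := by
  rw [Psh.post, Psh.app_lam, lift_fst_assoc]

/-- A projection as a section of the restricted function space. -/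
def Psh.postV (H : Psh) {c d : Dom} {p : c ⟶ d} (hp : IsProj p) : H ⟶ Psh.fnV c d :=
  Psh.ofClosed (F := Psh.fnV c d) H ⟨El.const p _, p, hp, rfl⟩

theorem Psh.ofClosed_fnVIncl (H : Psh) {c d : Dom} (x : (Psh.fnV c d).closed) {p : c ⟶ d}
    (hx : x.1 = El.const p _) :
    Psh.ofClosed (F := Psh.fnV c d) H x ≫ Psh.fnVIncl c d = Psh.post H p := by
  obtain ⟨x, hx'⟩ := x
  obtain rfl := hx
  rfl

theorem Psh.lam_app_app {H : Psh} {c d e : Dom} (p : c ⟶ d) (q : d ⟶ e)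
    {s : Psh.el c ⊗ H ⟶ (Psh.el d).fn (Psh.el e)} (hs : s = Psh.post _ q) :
    Psh.lam (Psh.app s (Psh.app (Psh.post _ p) (fst (Psh.el c) H))) = Psh.post H (p ≫ q) := by
  rw [hs, Psh.app_post, Psh.app_post, Psh.post, Functor.map_comp, Category.assoc]

theorem Psh.postV_fnVIncl (H : Psh) {c d : Dom} {p : c ⟶ d} (hp : IsProj p) :
    Psh.postV H hp ≫ Psh.fnVIncl c d = Psh.post H p :=
  Psh.ofClosed_fnVIncl H _ rfl

/-! ### Interpretation of domain variables and weakenings -/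

theorem HasTm.congr {Δ : CrispCtx} {Θ : Δ.pts → List Psh} {m : Exp} {X : Δ.pts → Psh}
    {s t : ∀ k, ctxPsh (Θ k) ⟶ X k} (h : HasTm Δ Θ m X s) (e : ∀ k, t k = s k) :
    HasTm Δ Θ m X t := by
  obtain rfl : t = s := funext e
  exact h

theorem hasTm_ordVar_zero (Δ : CrispCtx) (Θ : Δ.pts → List Psh) (X : Δ.pts → Psh) :
    HasTm Δ (fun k => X k :: Θ k) (.ordVar 0) X (fun k => fst (X k) (ctxPsh (Θ k))) :=
  .ordVar fun _ => .zero _ _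

theorem hasTm_ordVar_one (Δ : CrispCtx) (Θ : Δ.pts → List Psh) (X Y : Δ.pts → Psh) :
    HasTm Δ (fun k => Y k :: X k :: Θ k) (.ordVar 1) X
      (fun k => snd (Y k) (ctxPsh (X k :: Θ k)) ≫ fst (X k) (ctxPsh (Θ k))) :=
  .ordVar fun _ => .succ _ (.zero _ _)

/-- `F` interprets the family of morphisms `p` in the modal type theory. -/
def InterpretsMor (Γ : List Decl) (F : Exp → Exp) {c d : Pts Γ → Dom} (p : ∀ k, c k ⟶ d k) : Prop :=
  ∀ (Θ : Pts Γ → List Psh) (m : Exp) (s : ∀ k, ctxPsh (Θ k) ⟶ Psh.el (c k)),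
    HasTm (denCtx Γ).crisp Θ m (fun k => Psh.el (c k)) s →
    HasTm (denCtx Γ).crisp Θ (F m) (fun k => Psh.el (d k)) (fun k => s k ≫ yoneda.map (p k))

theorem InterpretsMor.comp {Γ : List Decl} {F G : Exp → Exp} {c d e : Pts Γ → Dom}
    {p : ∀ k, c k ⟶ d k} {q : ∀ k, d k ⟶ e k} (hF : InterpretsMor Γ F p)
    (hG : InterpretsMor Γ G q) : InterpretsMor Γ (fun m => G (F m)) (fun k => p k ≫ q k) :=
  fun Θ m s h => (hG Θ _ _ (hF Θ m s h)).congr fun k => by simp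

theorem InterpretsMor.id (Γ : List Decl) (c : Pts Γ → Dom) :
    InterpretsMor Γ (fun m => m) (fun k => 𝟙 (c k)) :=
  fun _ _ _ h => h.congr fun k => by simp

theorem WfDCtx.interpretsMor_fst {Γ : List Decl} {Ψ : DCtx} (h : WfDCtx Γ Ψ) (A : CoTy) :
    InterpretsMor Γ (.fst Ψ.interp A.interp)
      (fun k => CartesianMonoidalCategory.fst (Ψ.den ((denCtx Γ).env k)) A.den) :=
  fun _ _ _ hm => .fst (c := fun k => Psh.obj _ (Ψ.den ((denCtx Γ).env k)))
    (d := fun _ => Psh.obj _ A.den) (h.interp_hasTm _) (A.interp_hasTm _ _) hm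

theorem WfDCtx.interpretsMor_snd {Γ : List Decl} {Ψ : DCtx} (h : WfDCtx Γ Ψ) (A : CoTy) :
    InterpretsMor Γ (.snd Ψ.interp A.interp)
      (fun k => CartesianMonoidalCategory.snd (Ψ.den ((denCtx Γ).env k)) A.den) :=
  fun _ _ _ hm => .snd (c := fun k => Psh.obj _ (Ψ.den ((denCtx Γ).env k)))
    (d := fun _ => Psh.obj _ A.den) (h.interp_hasTm _) (A.interp_hasTm _ _) hm

theorem DLookup.interpretsMor {Γ : List Decl} {Ψ : DCtx} {n : ℕ} {A : CoTy} (h : DLookup Ψ n A)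
    (hΨ : WfDCtx Γ Ψ) : ∃ p : ∀ k : Pts Γ, Ψ.den ((denCtx Γ).env k) ⟶ A.den,
      (∀ k, IsProj (p k)) ∧ InterpretsMor Γ (Ψ.proj n) p := by
  induction h with
  | zero Ψ A =>
    cases hΨ with
    | snoc _ hΨ => exact ⟨_, fun _ => .snd _ _, hΨ.interpretsMor_snd A⟩
  | succ B _ ih =>
    cases hΨ with
    | snoc _ hΨ =>
      obtain ⟨p, hp, h⟩ := ih hΨ
      exact ⟨_, fun k => .fst _ (hp k), (hΨ.interpretsMor_fst B).comp h⟩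

theorem DCtx.fstPow_zero (Ψ : DCtx) (m : Exp) : Ψ.fstPow 0 m = m := by
  cases Ψ <;> rfl

theorem DCtx.interpretsMor_fstPow {Γ : List Decl} (Ψ : DCtx) (As : List CoTy)
    (h : WfDCtx Γ (Ψ.append As)) :
    ∃ p : ∀ k : Pts Γ, (Ψ.append As).den ((denCtx Γ).env k) ⟶ Ψ.den ((denCtx Γ).env k),
      (∀ k d (q : Ψ.den ((denCtx Γ).env k) ⟶ d), IsProj q → IsProj (p k ≫ q)) ∧
      InterpretsMor Γ ((Ψ.append As).fstPow As.length) p := by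
  induction As with
  | nil =>
    refine ⟨fun k => 𝟙 _, fun k d q hq => ?_, ?_⟩
    · change IsProj (𝟙 (Ψ.den ((denCtx Γ).env k)) ≫ q)
      rwa [Category.id_comp]
    · intro Θ m s hm
      rw [List.length_nil, DCtx.fstPow_zero]
      exact InterpretsMor.id Γ _ Θ m s hm
  | cons A As ih =>
    cases h with
    | snoc _ h =>
      obtain ⟨p, hp, hF⟩ := ih h
      refine ⟨fun k => CartesianMonoidalCategory.fst _ A.den ≫ p k, fun k d q hq => ?_,
        (h.interpretsMor_fst A).comp hF⟩
      change IsProj ((CartesianMonoidalCategory.fst ((Ψ.append As).den ((denCtx Γ).env k)) A.den ≫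
        p k) ≫ q)
      rw [Category.assoc]
      exact .fst _ (hp k d q hq)

theorem InterpretsMor.lam {Γ : List Decl} {F : Exp → Exp} {Ψ : DCtx} {d : Pts Γ → Dom}
    {p : ∀ k, Ψ.den ((denCtx Γ).env k) ⟶ d k} (hF : InterpretsMor Γ F p) (hΨ : WfDCtx Γ Ψ)
    (Θ : Pts Γ → List Psh) :
    HasTm (denCtx Γ).crisp Θ (.lam (.tyEl Ψ.interp) (F (.ordVar 0)))
      (fun k => (Psh.el (Ψ.den ((denCtx Γ).env k))).fn (Psh.el (d k)))
      (fun k => Psh.post _ (p k)) :=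
  .lam hΨ.interp_hasTy (hF _ _ _ (hasTm_ordVar_zero _ _ _))

theorem DLookup.interpVar_hasTm {Γ : List Decl} {Ψ : DCtx} {n : ℕ} {A : CoTy} (h : DLookup Ψ n A)
    (hΨ : WfDCtx Γ Ψ) (Θ : Pts Γ → List Psh) :
    ∃ s, HasTm (denCtx Γ).crisp Θ (interpVar Ψ n)
      (fun k => Psh.fnV (Ψ.den ((denCtx Γ).env k)) A.den) s := by
  obtain ⟨p, hp, h⟩ := h.interpretsMor hΨ
  exact ⟨fun k => Psh.postV _ (hp k),
    .toFnV ((h.lam hΨ Θ).congr fun k => Psh.postV_fnVIncl _ (hp k))⟩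

theorem DSubD.wk_hasTm {Γ : List Decl} {Ψ : DCtx} {E : ECtx} {Φ : DCtx} (d : DSubD Γ Ψ (.wk E) Φ) :
    ∃ p : ∀ k : Pts Γ, Ψ.den ((denCtx Γ).env k) ⟶ Φ.den ((denCtx Γ).env k),
      (∀ k d (q : Φ.den ((denCtx Γ).env k) ⟶ d), IsProj q → IsProj (p k ≫ q)) ∧
      ∀ Θ : Pts Γ → List Psh, HasTm (denCtx Γ).crisp Θ d.interp
        (fun k => (Psh.el (Ψ.den ((denCtx Γ).env k))).fn (Psh.el (Φ.den ((denCtx Γ).env k))))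
        (fun k => Psh.post _ (p k)) := by
  cases d with
  | wk As h =>
    obtain ⟨p, hp, hF⟩ := DCtx.interpretsMor_fstPow Φ As h
    exact ⟨p, hp, fun Θ => hF.lam h Θ⟩

/-! ### Interpretation of unboxing -/

theorem HasTy.el_cwk {Δ : CrispCtx} {e : Exp} {X : Δ.pts → Psh} (h : HasTy Δ (.tyEl e) X)
    (Y : Δ.pts → Psh) : HasTy (Δ.ext Y) (.tyEl e.cwk) (fun k => X k.1) := by
  cases h with
  | el h => exact .el (h.cwk Y)

theorem hasTm_crispVar_zero (Δ : CrispCtx) (X : Δ.pts → Psh) (Θ : (Δ.ext X).pts → List Psh) :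
    HasTm (Δ.ext X) Θ (.crispVar 0) (fun k => X k.1)
      (fun k => Psh.ofClosed (F := X k.1) _ k.2) :=
  .crispVar rfl

theorem interpUnbox_hasTm {Δ : CrispCtx} {Θ : Δ.pts → List Psh} {Ψ : DCtx} {e₁ e₂ : Exp}
    {c d a : Δ.pts → Dom} (hΨ : HasTy Δ (.tyEl Ψ.interp) (fun k => Psh.el (c k)))
    (h₁ : ∃ s, HasTm Δ Θ e₁ (fun k => ((Psh.el (d k)).fn (Psh.el (a k))).flat) s)
    (h₂ : ∀ Θ, ∃ s, HasTm Δ Θ e₂ (fun k => (Psh.el (c k)).fn (Psh.el (d k))) s) :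
    ∃ s, HasTm Δ Θ (interpUnbox Ψ e₁ e₂) (fun k => (Psh.el (c k)).fn (Psh.el (a k))) s := by
  obtain ⟨s, h₁⟩ := h₁
  obtain ⟨t, h₂⟩ := h₂ fun k => Psh.el (c k) :: Θ k
  exact ⟨_, .letbox h₁ (.lam (hΨ.el_cwk _)
    (.app (hasTm_crispVar_zero _ _ _) (.app (h₂.cwk _) (hasTm_ordVar_zero _ _ _))))⟩

theorem interpUnbox_hasTm_of_fnV {Δ : CrispCtx} {Θ : Δ.pts → List Psh} {Ψ : DCtx} {e₁ e₂ : Exp}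
    {c d a : Δ.pts → Dom} (hΨ : HasTy Δ (.tyEl Ψ.interp) (fun k => Psh.el (c k)))
    (h₁ : ∃ s, HasTm Δ Θ e₁ (fun k => (Psh.fnV (d k) (a k)).flat) s)
    (h₂ : ∀ Θ, ∃ s, HasTm Δ Θ e₂ (fun k => (Psh.el (c k)).fn (Psh.el (d k))) s) :
    ∃ s, HasTm Δ Θ (interpUnbox Ψ e₁ e₂) (fun k => (Psh.el (c k)).fn (Psh.el (a k))) s := by
  obtain ⟨s, h₁⟩ := h₁
  obtain ⟨t, h₂⟩ := h₂ fun k => Psh.el (c k) :: Θ k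
  exact ⟨_, .letbox h₁ (.lam (hΨ.el_cwk _)
    (.app (.ofFnV (hasTm_crispVar_zero _ _ _)) (.app (h₂.cwk _) (hasTm_ordVar_zero _ _ _))))⟩

theorem interpUnbox_hasTm_fnV {Δ : CrispCtx} {Θ : Δ.pts → List Psh} {Ψ : DCtx} {e₁ e₂ : Exp}
    {c d a : Δ.pts → Dom} (hΨ : HasTy Δ (.tyEl Ψ.interp) (fun k => Psh.el (c k)))
    (h₁ : ∃ s, HasTm Δ Θ e₁ (fun k => (Psh.fnV (d k) (a k)).flat) s)
    {p : ∀ k, c k ⟶ d k} (hp : ∀ k (q : d k ⟶ a k), IsProj q → IsProj (p k ≫ q))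
    (h₂ : ∀ Θ, HasTm Δ Θ e₂ (fun k => (Psh.el (c k)).fn (Psh.el (d k)))
      (fun k => Psh.post _ (p k))) :
    ∃ s, HasTm Δ Θ (interpUnbox Ψ e₁ e₂) (fun k => Psh.fnV (c k) (a k)) s := by
  obtain ⟨s, h₁⟩ := h₁
  have h : ∀ k : (Δ.ext fun k => Psh.fnV (d k) (a k)).pts, ∃ q : d k.1 ⟶ a k.1,
      IsProj q ∧ k.2.1 = El.const q _ := fun k => k.2.2
  choose q hq hk using h
  refine ⟨_, .letbox (X := fun k => Psh.fnV (d k) (a k)) (Y := fun k => Psh.fnV (c k) (a k))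
    (t := fun k => Psh.postV (ctxPsh (Θ k.1)) (hp k.1 (q k) (hq k))) h₁ (.toFnV ?_)⟩
  refine HasTm.congr (.lam (hΨ.el_cwk _) (.app (.ofFnV (hasTm_crispVar_zero _ _ _))
    (.app ((h₂ fun k => Psh.el (c k) :: Θ k).cwk _) (hasTm_ordVar_zero _ _ _)))) fun k => ?_
  exact (Psh.postV_fnVIncl _ _).trans
    (Psh.lam_app_app (p k.1) (q k) (Psh.ofClosed_fnVIncl _ _ (hk k))).symm

/-! ### Soundness of the interpretation -/

/-- `Δ | Θ ⊢ m : X` for some denotation of `m`. -/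
def IsTm (Δ : CrispCtx) (Θ : Δ.pts → List Psh) (m : Exp) (X : Δ.pts → Psh) : Prop :=
  ∃ s, HasTm Δ Θ m X s

theorem IsTm.of_eq {Δ : CrispCtx} {Θ : Δ.pts → List Psh} {m : Exp} {X Y : Δ.pts → Psh}
    (h : IsTm Δ Θ m X) (e : ∀ k, X k = Y k) : IsTm Δ Θ m Y := by
  obtain rfl : X = Y := funext e
  exact h

theorem IsTm.crispLam {Δ : CrispCtx} {Θ : Δ.pts → List Psh} {T m : Exp} {X : Δ.pts → Psh}
    {Y : (Δ.ext X).pts → Psh} (hT : HasTy Δ T X) (h : IsTm (Δ.ext X) (fun k => Θ k.1) m Y) :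
    IsTm Δ Θ (.crispLam T m) (fun k => (X k).crispFn fun x => Y ⟨k, x⟩) :=
  let ⟨_, h⟩ := h
  ⟨_, .crispLam hT h⟩

theorem cLam_isTm (Δ : CrispCtx) (Θ : Δ.pts → List Psh) :
    IsTm Δ Θ (.arrowI (.lam (.tyEl (.arrow .tm .tm))
        (.domLam (.lam (.tyEl .tm) (.arrowE .tm .tm (.ordVar 1) (.ordVar 0))))))
      (fun _ => Psh.el (Dom.arrow (Dom.arrow Dom.tm Dom.tm) Dom.tm)) := by
  have htm (Θ : Δ.pts → List Psh) :
      HasTm Δ Θ .tm (fun _ => Psh.objs) (fun _ => Psh.obj _ Dom.tm) := .tm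
  have h : HasTm Δ _ (.arrowE .tm .tm (.ordVar 1) (.ordVar 0)) (fun _ => Psh.el Dom.tm) _ :=
    .arrowE (htm _) (htm _)
      (hasTm_ordVar_one Δ Θ (fun _ => Psh.el (Dom.arrow Dom.tm Dom.tm)) (fun _ => Psh.el Dom.tm))
      (hasTm_ordVar_zero Δ _ (fun _ => Psh.el Dom.tm))
  exact ⟨_, .arrowI (c := fun _ => Dom.arrow Dom.tm Dom.tm) (d := fun _ => Dom.tm)
    (.lam (.el (.arrow (htm _) (htm _))) (.domLam (.lam (.el (htm _)) h)))⟩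

theorem cApp_isTm (Δ : CrispCtx) (Θ : Δ.pts → List Psh) :
    IsTm Δ Θ (.arrowI (.lam (.tyEl .tm)
        (.arrowI (.lam (.tyEl .tm) (.domApp (.ordVar 1) (.ordVar 0))))))
      (fun _ => Psh.el (Dom.arrow Dom.tm (Dom.arrow Dom.tm Dom.tm))) := by
  have htm : HasTy Δ (.tyEl .tm) (fun _ => Psh.el Dom.tm) :=
    .el (c := fun _ => Psh.obj _ Dom.tm) .tm
  exact ⟨_, .arrowI (c := fun _ => Dom.tm) (d := fun _ => Dom.arrow Dom.tm Dom.tm)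
    (.lam htm (.arrowI (c := fun _ => Dom.tm) (d := fun _ => Dom.tm) (.lam htm
      (.domApp (hasTm_ordVar_one _ _ _ _) (hasTm_ordVar_zero _ _ _)))))⟩

/-- Well-typed terms over the denotation of a computation context. -/
abbrev IsTmOver (Γ : List Decl) (Θ : Pts Γ → List Psh) (m : Exp)
    (X : (ℕ → Dom) → Psh) : Prop :=
  IsTm (denCtx Γ).crisp Θ m (fun k => X ((denCtx Γ).env k))

theorem IsTm.crispLam_ty {Γ : List Decl} {σ : Ty} {m : Exp} {Y : Pts (.ty σ :: Γ) → Psh}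
    (hσ : WfTy Γ σ) (h : IsTm (denCtx (.ty σ :: Γ)).crisp (fun _ => []) m Y) :
    IsTm (denCtx Γ).crisp (fun _ => []) (.crispLam σ.interp m)
      (fun k => (σ.den ((denCtx Γ).env k)).crispFn fun x => Y ⟨k, x⟩) :=
  .crispLam hσ.interp_hasTy h

theorem IsTm.crispLam_ctx {Γ : List Decl} {m : Exp} {Y : Pts (.ctx :: Γ) → Psh}
    (h : IsTm (denCtx (.ctx :: Γ)).crisp (fun _ => []) m Y) :
    IsTm (denCtx Γ).crisp (fun _ => []) (.crispLam .tyObj m)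
      (fun k => Psh.objs.crispFn fun c => Y ⟨k, c⟩) :=
  .crispLam .obj h

theorem Psh.crispFn_congr {X X' Y Y' : Psh} (hX : X = X') (hY : Y = Y') :
    (X.crispFn fun _ => Y) = X'.crispFn fun _ => Y' := by
  rw [hX, hY]

/-- The family of presheaves denoted by a type over `Γ, ψ:ctx`. -/
def Ty.family {Γ : List Decl} (τ : Ty) (k : Pts Γ) (c : Dom) : Psh :=
  τ.den (consEnv c ((denCtx Γ).env k))

theorem wfDCtx_last (Γ : List Decl) : WfDCtx (.ctx :: Γ) (.ctxVar 0) := .ctxVar (.ctx_zero _)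

theorem wfDCtx_second (Γ : List Decl) (D : Decl) : WfDCtx (D :: .ctx :: Γ) (.ctxVar 1) :=
  .ctxVar (.ctx_succ _ (.ctx_zero _))

theorem WfTy.subst_snoc {Γ : List Decl} {τ : Ty} (h : WfTy (.ctx :: Γ) τ) (D : Decl) (A : CoTy) :
    WfTy (D :: .ctx :: Γ) (τ.subst fun
      | 0 => .snoc (.ctxVar 1) A
      | i + 1 => .ctxVar (i + 2)) := by
  refine h.subst ?_
  rintro (_ | n) hn
  · exact .snoc _ (wfDCtx_second _ _)
  · exact .ctxVar (.ctx_succ _ (.ctx_succ _ hn.of_ctx_succ))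

theorem varBranch_isTm {Γ : List Decl} {τ : Ty} {m : Exp}
    (h : IsTmOver (.ty (.box (.var (.ctxVar 0) .tm)) :: .ctx :: Γ) (fun _ => []) m
      fun ρ => (τ.shift 1).den ρ) :
    IsTm (denCtx Γ).crisp (fun _ => [])
      (.crispLam .tyObj (.crispLam (.tyBox (.tyFnV (.crispVar 0) .tm)) m))
      (fun k => Psh.varBranch (τ.family k)) := by
  refine (IsTm.crispLam_ctx (.crispLam_ty (.boxVar _ (wfDCtx_last Γ)) h)).of_eq fun k => ?_
  refine congrArg Psh.objs.crispFn (funext fun c => ?_)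
  exact Psh.crispFn_congr (X := (Psh.fnV c Dom.tm).flat) rfl
    (τ.den_shift 1 (consEnv (𝟙_ Dom) (consEnv c ((denCtx Γ).env k))))

theorem appBranch_isTm {Γ : List Decl} {τ : Ty} {m : Exp} (hτ : WfTy (.ctx :: Γ) τ)
    (h : IsTmOver (.ty (τ.shift 3) :: .ty (τ.shift 2) ::
        .ty (.box (.tm (.ctxVar 1) .tm)) :: .ty (.box (.tm (.ctxVar 0) .tm)) :: .ctx :: Γ)
        (fun _ => []) m fun ρ => (τ.shift 4).den ρ) :
    IsTm (denCtx Γ).crisp (fun _ => [])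
      (.crispLam .tyObj
        (.crispLam (.tyBox (.tyFn (.tyEl (.crispVar 0)) (.tyEl .tm)))
          (.crispLam (.tyBox (.tyFn (.tyEl (.crispVar 1)) (.tyEl .tm)))
            (.crispLam (τ.shift 2).interp (.crispLam (τ.shift 3).interp m)))))
      (fun k => Psh.appBranch (τ.family k)) := by
  refine (IsTm.crispLam_ctx (.crispLam_ty (.boxTm _ (wfDCtx_last Γ))
    (.crispLam_ty (.boxTm _ (wfDCtx_second _ _)) (.crispLam_ty (hτ.shift [_, _])
      (.crispLam_ty (hτ.shift [_, _, _]) h))))).of_eq fun k => ?_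
  refine congrArg Psh.objs.crispFn (funext fun c => ?_)
  let up := consEnv (𝟙_ Dom)
  let ρ := consEnv c ((denCtx Γ).env k)
  exact Psh.crispFn_congr (X := (Psh.tmIn c).flat) rfl (Psh.crispFn_congr (X := (Psh.tmIn c).flat)
    rfl (Psh.crispFn_congr (τ.den_shift 2 (up (up ρ))) (Psh.crispFn_congr
      (τ.den_shift 3 (up (up (up ρ)))) (τ.den_shift 4 (up (up (up (up ρ))))))))

theorem lamBranch_isTm {Γ : List Decl} {τ : Ty} {m : Exp} (hτ : WfTy (.ctx :: Γ) τ)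
    (h : IsTmOver (.ty (τ.subst fun
            | 0 => .snoc (.ctxVar 1) .tm
            | i + 1 => .ctxVar (i + 2)) ::
          .ty (.box (.tm (.snoc (.ctxVar 0) .tm) .tm)) :: .ctx :: Γ)
        (fun _ => []) m fun ρ => (τ.shift 2).den ρ) :
    IsTm (denCtx Γ).crisp (fun _ => [])
      (.crispLam .tyObj
        (.crispLam (.tyBox (.tyFn (.tyEl (.times (.crispVar 0) .tm)) (.tyEl .tm)))
          (.crispLam (τ.subst fun
              | 0 => .snoc (.ctxVar 1) .tm
              | i + 1 => .ctxVar (i + 2)).interp m)))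
      (fun k => Psh.lamBranch (τ.family k)) := by
  refine (IsTm.crispLam_ctx (.crispLam_ty (.boxTm _ (.snoc _ (wfDCtx_last Γ)))
    (.crispLam_ty (hτ.subst_snoc _ _) h))).of_eq fun k => ?_
  refine congrArg Psh.objs.crispFn (funext fun c => ?_)
  let up := consEnv (𝟙_ Dom)
  let ρ := consEnv c ((denCtx Γ).env k)
  refine Psh.crispFn_congr (X := (Psh.tmIn (c ⊗ Dom.tm : Dom)).flat) rfl
    (Psh.crispFn_congr ((τ.den_subst _ (up ρ)).trans ?_) (τ.den_shift 2 (up (up ρ))))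
  refine congrArg (fun ρ => τ.den ρ) (funext fun n => ?_)
  cases n <;> rfl

/-- The functions from the denotation of `Ψ` to an object. -/
def elFn (Ψ : DCtx) (X : (ℕ → Dom) → Dom) (ρ : ℕ → Dom) : Psh :=
  (Psh.el (Ψ.den ρ)).fn (Psh.el (X ρ))

mutual

theorem DTmD.interp_isTm {Γ : List Decl} {Ψ : DCtx} {M : DTm} {A : CoTy} :
    (d : DTmD Γ Ψ M A) → WfCtx Γ → ∀ Θ : Pts Γ → List Psh,
      IsTmOver Γ Θ d.interp (elFn Ψ fun _ => A.den)
  | .var hΨ h, _, Θ => by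
    obtain ⟨p, _, h⟩ := h.interpretsMor hΨ
    exact ⟨_, h.lam hΨ Θ⟩
  | .cLam hΨ, _, Θ => by
    obtain ⟨_, h⟩ := cLam_isTm _ _
    exact ⟨_, .lam hΨ.interp_hasTy h⟩
  | .cApp hΨ, _, Θ => by
    obtain ⟨_, h⟩ := cApp_isTm _ _
    exact ⟨_, .lam hΨ.interp_hasTy h⟩
  | .app (A := A) (B := B) d₁ d₂, hΓ, Θ => by
    obtain ⟨_, h₁⟩ := d₁.interp_isTm hΓ fun k => Psh.el (Ψ.den ((denCtx Γ).env k)) :: Θ k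
    obtain ⟨_, h₂⟩ := d₂.interp_isTm hΓ fun k => Psh.el (Ψ.den ((denCtx Γ).env k)) :: Θ k
    exact ⟨_, .lam d₁.wf.interp_hasTy
      (.arrowE (c := fun _ => Psh.obj _ A.den) (d := fun _ => Psh.obj _ B.den)
        (A.interp_hasTm _ _) (B.interp_hasTm _ _)
        (.app h₁ (hasTm_ordVar_zero _ _ _)) (.app h₂ (hasTm_ordVar_zero _ _ _)))⟩
  | .lam (A := A) (B := B) d, hΓ, Θ => by
    obtain ⟨_, h⟩ := d.interp_isTm hΓ fun k =>
      Psh.el A.den :: Psh.el (Ψ.den ((denCtx Γ).env k)) :: Θ k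
    exact ⟨_, .lam (DTmD.lam d).wf.interp_hasTy
      (.arrowI (c := fun _ => A.den) (d := fun _ => B.den) (.lam (A.interp_hasTy _)
        (.app h (.pair (c := fun k => Ψ.den ((denCtx Γ).env k)) (d := fun _ => A.den)
          (hasTm_ordVar_one _ _ _ _) (hasTm_ordVar_zero _ _ _)))))⟩
  | .unbox d₁ d₂, hΓ, Θ =>
    interpUnbox_hasTm d₂.wf.1.interp_hasTy (d₁.interp_isTm hΓ Θ) (d₂.interp_isTm hΓ)
  | .unboxVar d₁ d₂, hΓ, Θ =>
    interpUnbox_hasTm_of_fnV d₂.wf.1.interp_hasTy (d₁.interp_isTm hΓ Θ) (d₂.interp_isTm hΓ)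

theorem DSubD.interp_isTm {Γ : List Decl} {Ψ : DCtx} {σ : DSub} {Φ : DCtx} :
    (d : DSubD Γ Ψ σ Φ) → WfCtx Γ → ∀ Θ : Pts Γ → List Psh,
      IsTmOver Γ Θ d.interp (elFn Ψ fun ρ => Φ.den ρ)
  | .wk As h, _, Θ => by
    obtain ⟨_, _, hw⟩ := (DSubD.wk As h).wk_hasTm
    exact ⟨_, hw Θ⟩
  | .nil hΨ, _, Θ => ⟨_, .lam hΨ.interp_hasTy .terminal⟩
  | .snoc (Ψ := Φ) (A := A) d₁ d₂, hΓ, Θ => by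
    obtain ⟨_, h₁⟩ := d₁.interp_isTm hΓ fun k => Psh.el (Ψ.den ((denCtx Γ).env k)) :: Θ k
    obtain ⟨_, h₂⟩ := d₂.interp_isTm hΓ fun k => Psh.el (Ψ.den ((denCtx Γ).env k)) :: Θ k
    exact ⟨_, .lam d₁.wf.1.interp_hasTy
      (.pair (c := fun k => Φ.den ((denCtx Γ).env k)) (d := fun _ => A.den)
        (.app h₁ (hasTm_ordVar_zero _ _ _)) (.app h₂ (hasTm_ordVar_zero _ _ _)))⟩

theorem CtxObjD.interp_isTm {Γ : List Decl} {C : CtxObj} {T : CtxTy} :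
    (d : CtxObjD Γ C T) → WfCtx Γ → ∀ Θ : Pts Γ → List Psh,
      IsTmOver Γ Θ d.interp fun ρ => T.den ρ
  | .tm d, hΓ, Θ => d.interp_isTm hΓ Θ
  | .var hΨ h, _, Θ => h.interpVar_hasTm hΨ Θ
  | .unboxVar h d, _, Θ => by
    obtain ⟨_, hp, hw⟩ := d.wk_hasTm
    obtain ⟨x, hx⟩ := h.den
    exact interpUnbox_hasTm_fnV d.wf.1.interp_hasTy ⟨_, .crispVar hx⟩ (fun k q => hp k _ q) hw

theorem TmD.interp_isTm {Γ : List Decl} {t : Tm} {τ : Ty} :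
    (d : TmD Γ t τ) → WfCtx Γ → ∀ Θ : Pts Γ → List Psh,
      IsTmOver Γ Θ d.interp fun ρ => τ.den ρ
  | .var h, _, Θ => by
    obtain ⟨x, hx⟩ := h.den
    exact ⟨_, .crispVar hx⟩
  | .box d, hΓ, Θ => by
    obtain ⟨_, h⟩ := d.interp_isTm hΓ fun _ => []
    exact ⟨_, .box h⟩
  | .app (τ₁ := τ₁) (τ₂ := τ₂) d₁ d₂, hΓ, Θ => by
    obtain ⟨_, h₁⟩ := d₁.interp_isTm hΓ Θ
    obtain ⟨_, h₂⟩ := d₂.interp_isTm hΓ fun _ => []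
    refine IsTm.of_eq ⟨_, .crispApp (X := fun k => τ₁.den ((denCtx Γ).env k))
      (Y := fun k => τ₂.den (consEnv (𝟙_ Dom) ((denCtx Γ).env k.1))) h₁ h₂⟩ fun k => ?_
    exact (τ₂.den_inst .nil _).symm
  | .appCtx (Ψ := Ψ) (τ₂ := τ₂) d hΨ, hΓ, Θ => by
    obtain ⟨_, h⟩ := d.interp_isTm hΓ Θ
    refine IsTm.of_eq ⟨_, .crispApp (X := fun _ => Psh.objs)
      (Y := fun k => τ₂.den (consEnv k.2 ((denCtx Γ).env k.1))) h (hΨ.interp_hasTm _)⟩ fun k => ?_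
    exact (τ₂.den_inst Ψ _).symm
  | .fn d h, hΓ, Θ => by
    cases h with
    | arr h h' => exact .crispLam h.interp_hasTy (d.interp_isTm (.ty hΓ h) fun k => Θ k.1)
  | .fnCtx d h, hΓ, Θ => .crispLam .obj (d.interp_isTm (.ctx hΓ) fun k => Θ k.1)
  | .recur (Ψ := Ψ) (τ := τ) d hI dv da dl, hΓ, Θ => by
    have hΨ : WfDCtx Γ Ψ := by cases d.wf hΓ; assumption
    have hτ := hI.of_recInv
    have hm : WfTy (.ctx :: Γ) (.box (.tm (.ctxVar 0) .tm)) := .boxTm _ (wfDCtx_last _)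
    have hn : WfTy (.ty (.box (.tm (.ctxVar 0) .tm)) :: .ctx :: Γ) (.box (.tm (.ctxVar 1) .tm)) :=
      .boxTm _ (wfDCtx_second _ _)
    obtain ⟨_, iv⟩ := varBranch_isTm
      (dv.interp_isTm (.ty hΓ.ctx (.boxVar _ (wfDCtx_last _))) fun _ => [])
    obtain ⟨_, ia⟩ := appBranch_isTm hτ (da.interp_isTm
      (.ty (.ty (.ty (.ty hΓ.ctx hm) hn) (hτ.shift [_, _])) (hτ.shift [_, _, _])) fun _ => [])
    obtain ⟨_, il⟩ := lamBranch_isTm hτ (dl.interp_isTm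
      (.ty (.ty hΓ.ctx (.boxTm _ (.snoc _ (wfDCtx_last _)))) (hτ.subst_snoc _ _)) fun _ => [])
    obtain ⟨_, it⟩ := d.interp_isTm hΓ Θ
    refine IsTm.of_eq ⟨_, .recur (A := fun k => τ.family k)
      (c := fun k => Psh.obj _ (Ψ.den ((denCtx Γ).env k))) iv ia il (hΨ.interp_hasTm _) it⟩
      fun k => ?_
    exact (τ.den_inst Ψ _).symm

end

theorem WfCtx.derivable {Γ : List Decl} (hΓ : WfCtx Γ) {m T : Exp} {X : (ℕ → Dom) → Psh}
    (hT : HasTy (denCtx Γ).crisp T (fun k => X ((denCtx Γ).env k)))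
    (hm : IsTmOver Γ (fun _ => []) m X) : Derivable (interpCtx Γ) m T :=
  let ⟨s, hs⟩ := hm
  ⟨_, _, s, hΓ.isCrispCtx, hT, hs⟩

end SimpleCocon

open SimpleCocon

theorem mainTheorem5 (Γ : List Decl) (hΓ : WfCtx Γ) :
    (∀ Ψ : DCtx, WfDCtx Γ Ψ → Derivable (interpCtx Γ) Ψ.interp .tyObj) ∧
    (∀ (Ψ : DCtx) (M : DTm) (A : CoTy) (d : DTmD Γ Ψ M A),
      Derivable (interpCtx Γ) d.interp (.tyFn (.tyEl Ψ.interp) (.tyEl A.interp))) ∧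
    (∀ (Ψ Φ : DCtx) (σ : DSub) (d : DSubD Γ Ψ σ Φ),
      Derivable (interpCtx Γ) d.interp (.tyFn (.tyEl Ψ.interp) (.tyEl Φ.interp))) ∧
    (∀ (C : CtxObj) (T : CtxTy) (d : CtxObjD Γ C T), Derivable (interpCtx Γ) d.interp T.interp) ∧
    (∀ (t : Tm) (τ : Ty) (d : TmD Γ t τ), Derivable (interpCtx Γ) d.interp τ.interp) := by
  refine ⟨fun Ψ h => ?_, fun Ψ M A d => ?_, fun Ψ Φ σ d => ?_, fun C T d => ?_, fun t τ d => ?_⟩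
  · exact hΓ.derivable (X := fun _ => Psh.objs) .obj ⟨_, h.interp_hasTm _⟩
  · exact hΓ.derivable (.fn d.wf.interp_hasTy (A.interp_hasTy _)) (d.interp_isTm hΓ _)
  · exact hΓ.derivable (.fn d.wf.1.interp_hasTy d.wf.2.interp_hasTy) (d.interp_isTm hΓ _)
  · refine hΓ.derivable ?_ (d.interp_isTm hΓ _)
    cases d.wf with
    | boxTm A h => exact .fn h.interp_hasTy (A.interp_hasTy _)
    | boxVar A h => exact .fnV (h.interp_hasTm _) (A.interp_hasTm _ _)
  · exact hΓ.derivable (d.wf hΓ).interp_hasTy (d.interp_isTm hΓ _)
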